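/- Let $(X,\mathrm{dist},\mu)$ be a metric space with a nonnegative $\sigma$-finite Borel measure which is Ahlfors regular of dimension $d>2$ ($d$ real): there are $c,C>0$ with $c\,r^d\le\mu(B(x,r))\le C\,r^d$ for all $x\in X$ and $0<r<\operatorname{diam}X$, where $B(x,r)$ is the open ball. Let $H$ be a densely defined, nonnegative, self-adjoint operator on the complex space $L^2=L^2(X,\mu)$ such that (i) for every $t>0$ the operator $e^{-tH}$ has a kernel $p_t$ with $p_t(x,x)\lesssim \mu(B(x,\sqrt t))^{-1}$ for a.e. $x$, where $p_t(x,x):=\int_X|p_{t/2}(x,y)|^2\,d\mu(y)$; (ii) (Davies–Gaffney) $\|e^{-tH}\|_{L^2(U)\to L^2(V)}\lesssim e^{-\mathrm{dist}(U,V)^2/(4t)}$ for all measurable $U,V\subset X$ and all $t>0$. Here $\|T\|_{L^2(U)\to L^2(V)}$ is the supremum of $\|Tf\|_{L^2(V)}$ over all $f\in L^2$ with $\|f\|_{L^2}\le1$ that vanish outside $U$. For integers $m\ge0$ let $\psi_m(x)=x^me^{-x}$; functions of $H$ are given by the functional calculus of $H$. Assume (wave dispersion) that there are $\kappa\in(0,\infty]$,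 an integer $m_0\ge0$ and a constant $C$ such that $$\|\cos(s\sqrt H)\,\psi_{m_0}(r^2H)\|_{L^2(B)\to L^2(\widetilde B)}\le C\Big(\frac r{r+s}\Big)^{\frac{d-1}2}$$ for all $0<s<\kappa$, all $r>0$ and any two balls $B,\widetilde B$ of radius $r$. **Theorem.** For all integers $m\ge\lceil d/2\rceil$ (in particular for $m=m_0$ if $m_0\ge\lceil d/2\rceil$) and $m'\ge0$: * if $\kappa=\infty$, there is a constant $C$ such that for all $r>0$, all balls $B,\widetilde B$ of radius $r$, all $0<h\le1$ and all real $t$ with $0<|t|\le1$, $$\|e^{itH}\psi_{m'}(h^2H)\psi_m(r^2H)\|_{L^2(B)\to L^2(\widetilde B)}\le C\,\frac{r^d}{|t|^{\frac{d-2}2}h^2};$$ * if $\kappa<\infty$, for every $\varepsilon>0$ there is a constant $C$ such that the same estimate holds for all $r>0$, all balls $B,\widetilde B$ of radius $r$, all $0<h\le1$ and all real $t$ with $h^2\le|t|\le h^{1+\varepsilon}$. The constants $C$ do not depend on $B,\widetilde B,r,h,t$. -/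

import Mathlib

open MeasureTheory Set Filter Topology
open scoped ENNReal ComplexOrder

noncomputable section

namespace WaveDispersion

/-! ### Nonnegative self-adjoint operators and their functional calculus -/

set_option linter.unusedSectionVars false

section Operator

variable {E : Type*} [NormedAddCommGroup E] [InnerProductSpace ℂ E] [CompleteSpace E]

/-- `H` is a densely defined, self-adjoint and nonnegative (unbounded) operator. -/
structure IsNonnegSelfAdjoint (H : E →ₗ.[ℂ] E) : Prop where
  dense : Dense (H.domain : Set E)
  selfAdjoint : IsSelfAdjoint H
  nonneg : ∀ u : H.domain, 0 ≤ (inner ℂ (u : E) (H u)).re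

/-- The map `u ↦ u + H u` on the domain of `H`. -/
def onePlus (H : E →ₗ.[ℂ] E) : H.domain →ₗ[ℂ] E := H.domain.subtype + H.toFun

/-- The resolvent `(1 + H)⁻¹`: the bounded operator with `(1 + H)⁻¹ (u + H u) = u`
for all `u` in the domain of `H` (see `resolvent_onePlus`). -/
def resolvent (H : E →ₗ.[ℂ] E) : E →L[ℂ] E :=
  H.domain.subtype.extendOfNorm (onePlus H)

/-- The bounded operator `(f(λ) / (1 + λ))(H)`, for `f` continuous and bounded on `[0, ∞)`.
With `z = 1 / (1 + λ)` one has `λ = z⁻¹ - 1` and `f(λ) / (1 + λ) = f(z⁻¹ - 1) z`, which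
extends continuously by `0` to `z = 0`, so that this is the continuous functional calculus of the
bounded self-adjoint operator `(1 + H)⁻¹`, whose spectrum lies in `[0, 1]`. -/
def damped (H : E →ₗ.[ℂ] E) (f : ℝ → ℂ) : E →L[ℂ] E :=
  cfc (fun z : ℂ => f ((z⁻¹).re - 1) * z) (resolvent H)

/-- The functional calculus `f(H)`, for `f` continuous and bounded on `[0, ∞)`: the bounded operator
with `f(H) (1 + H)⁻¹ = (f(λ) / (1 + λ))(H)` (see `funcCalc_resolvent`). -/
def funcCalc (H : E →ₗ.[ℂ] E) (f : ℝ → ℂ) : E →L[ℂ] E :=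
  (damped H f : E →ₗ[ℂ] E).extendOfNorm (resolvent H : E →ₗ[ℂ] E)

variable {H : E →ₗ.[ℂ] E}

lemma onePlus_apply (u : H.domain) : onePlus H u = (u : E) + H u := rfl


lemma IsNonnegSelfAdjoint.adjoint_eq (hH : IsNonnegSelfAdjoint H) : H.adjoint = H :=
  LinearPMap.isSelfAdjoint_def.mp hH.selfAdjoint

lemma IsNonnegSelfAdjoint.symm (hH : IsNonnegSelfAdjoint H) (u v : H.domain) :
    inner ℂ (H u) (v : E) = inner ℂ (u : E) (H v) := by
  have h := LinearPMap.adjoint_isFormalAdjoint (T := H) hH.dense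
  rw [hH.adjoint_eq] at h
  exact h u v

lemma IsNonnegSelfAdjoint.norm_le_onePlus (hH : IsNonnegSelfAdjoint H) (u : H.domain) :
    ‖(u : E)‖ ≤ 1 * ‖onePlus H u‖ := by
  have h1 : ‖(u : E)‖ ^ 2 ≤ (inner ℂ (u : E) (onePlus H u)).re := by
    rw [onePlus_apply, inner_add_right, Complex.add_re, inner_self_eq_norm_sq_to_K]
    have := hH.nonneg u
    have h3 : (((‖(u : E)‖ : ℝ) : ℂ) ^ 2).re = ‖(u : E)‖ ^ 2 := by norm_cast
    exact h3.symm.le.trans (le_add_of_nonneg_right this)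
  have h2 : (inner ℂ (u : E) (onePlus H u)).re ≤ ‖(u : E)‖ * ‖onePlus H u‖ :=
    (Complex.re_le_norm _).trans (norm_inner_le_norm _ _)
  rcases (norm_nonneg (u : E)).eq_or_lt with h0 | h0
  · rw [← h0, one_mul]; exact norm_nonneg _
  · nlinarith

lemma IsNonnegSelfAdjoint.denseRange_onePlus (hH : IsNonnegSelfAdjoint H) :
    DenseRange (onePlus H) := by
  have key : (LinearMap.range (onePlus H))ᗮ = ⊥ := by
    rw [Submodule.eq_bot_iff]
    intro v hv
    have hv' : ∀ u : H.domain, inner ℂ v (onePlus H u) = 0 := fun u =>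
      (Submodule.mem_orthogonal' _ _).mp hv _ ⟨u, rfl⟩
    have hw : ∀ u : H.domain, inner ℂ (-v) (u : E) = inner ℂ v (H u) := by
      intro u
      have := hv' u
      rw [onePlus_apply, inner_add_right] at this
      rw [inner_neg_left]
      linear_combination -this
    have hmem : v ∈ H.adjoint.domain := LinearPMap.mem_adjoint_domain_of_exists v ⟨-v, hw⟩
    have hval : H.adjoint ⟨v, hmem⟩ = -v := LinearPMap.adjoint_apply_eq hH.dense ⟨v, hmem⟩ hw
    have hex : ∃ u : H.domain, (u : E) = v ∧ H u = -v := by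
      have h2 := hH.adjoint_eq
      revert hmem
      rw [h2]
      intro hmem hval
      exact ⟨⟨v, hmem⟩, rfl, hval⟩
    obtain ⟨u, hu, hHu⟩ := hex
    have h3 := hH.nonneg u
    rw [hu, hHu, inner_neg_right, inner_self_eq_norm_sq_to_K] at h3
    have h5 : (-((‖v‖ : ℝ) : ℂ) ^ 2).re = -‖v‖ ^ 2 := by norm_cast
    have h4 : ‖v‖ = 0 := by
      have h6 : 0 ≤ -‖v‖ ^ 2 := h5 ▸ h3
      nlinarith [norm_nonneg v]
    exact norm_eq_zero.mp h4
  have := (Submodule.topologicalClosure_eq_top_iff).mpr key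
  rw [DenseRange, ← LinearMap.coe_range]
  exact (Submodule.dense_iff_topologicalClosure_eq_top).mpr this

lemma resolvent_onePlus (hH : IsNonnegSelfAdjoint H) (u : H.domain) :
    resolvent H ((u : E) + H u) = u :=
  LinearMap.extendOfNorm_eq hH.denseRange_onePlus ⟨1, hH.norm_le_onePlus⟩ u

lemma IsNonnegSelfAdjoint.denseRange_resolvent (hH : IsNonnegSelfAdjoint H) :
    DenseRange (resolvent H) :=
  hH.dense.mono fun u hu => ⟨_, resolvent_onePlus hH ⟨u, hu⟩⟩

lemma resolvent_nonneg (hH : IsNonnegSelfAdjoint H) : 0 ≤ resolvent H := by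
  rw [ContinuousLinearMap.nonneg_iff_isPositive]
  have hsym : ∀ v w : E, inner ℂ (resolvent H v) w = inner ℂ v (resolvent H w) := by
    intro v w
    refine hH.denseRange_onePlus.induction_on₂
      (p := fun v w => inner ℂ (resolvent H v) w = inner ℂ v (resolvent H w)) ?_ ?_ v w
    · exact isClosed_eq (by fun_prop) (by fun_prop)
    · intro a b
      simp only [onePlus_apply, resolvent_onePlus hH, inner_add_left, inner_add_right, hH.symm]
  refine ⟨hsym, fun v => ?_⟩
  refine hH.denseRange_onePlus.induction_on (p := fun v => 0 ≤ (resolvent H).reApplyInnerSelf v) v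
    ?_ ?_
  · exact isClosed_le continuous_const (ContinuousLinearMap.reApplyInnerSelf_continuous _)
  · intro a
    simp only [ContinuousLinearMap.reApplyInnerSelf_apply, onePlus_apply, resolvent_onePlus hH,
      inner_add_right, map_add]
    exact add_nonneg inner_self_nonneg (hH.nonneg a)

lemma norm_resolvent_le (hH : IsNonnegSelfAdjoint H) : ‖resolvent H‖ ≤ 1 :=
  LinearMap.opNorm_extendOfNorm_le hH.denseRange_onePlus zero_le_one hH.norm_le_onePlus

/-- The spectrum of `(1 + H)⁻¹` lies in `[0, 1]`. -/
lemma spectrum_resolvent (hH : IsNonnegSelfAdjoint H) {z : ℂ}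
    (hz : z ∈ spectrum ℂ (resolvent H)) : 0 ≤ z ∧ z.re ≤ 1 := by
  have h0 : 0 ≤ z := spectrum_nonneg_of_nonneg (resolvent_nonneg hH) hz
  refine ⟨h0, (Complex.re_le_norm z).trans ?_⟩
  rcases subsingleton_or_nontrivial E with h | h
  · have : IsEmpty E → False := fun h => h.false 0
    exfalso
    have : Subsingleton (E →L[ℂ] E) := inferInstance
    rw [spectrum.of_subsingleton] at hz
    exact hz
  · exact (spectrum.norm_le_norm_of_mem hz).trans (norm_resolvent_le hH)

lemma continuousOn_damped (hH : IsNonnegSelfAdjoint H) {f : ℝ → ℂ} (hf : ContinuousOn f (Ici 0))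
    {M : ℝ} (hM : ∀ x, 0 ≤ x → ‖f x‖ ≤ M) :
    ContinuousOn (fun z : ℂ => f ((z⁻¹).re - 1) * z) (spectrum ℂ (resolvent H)) := by
  have hnn : ∀ z ∈ spectrum ℂ (resolvent H), z ≠ 0 → 0 ≤ (z⁻¹).re - 1 := by
    intro z hz h0
    obtain ⟨h1, h2⟩ := spectrum_resolvent hH hz
    obtain ⟨hre, him⟩ := Complex.nonneg_iff.mp h1
    have hzr : z = (z.re : ℂ) := Complex.ext rfl (by simpa using him.symm)
    have hpos : 0 < z.re := lt_of_le_of_ne hre (fun h => h0 (by rw [hzr, ← h]; simp))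
    rw [hzr, ← Complex.ofReal_inv, Complex.ofReal_re, sub_nonneg]
    exact (one_le_inv₀ hpos).mpr h2
  have hbd : ∀ z ∈ spectrum ℂ (resolvent H), ‖f ((z⁻¹).re - 1) * z‖ ≤ M * ‖z‖ := by
    intro z hz
    rcases eq_or_ne z 0 with h | h
    · simp [h]
    · rw [norm_mul]
      exact mul_le_mul_of_nonneg_right (hM _ (hnn z hz h)) (norm_nonneg z)
  intro z hz
  rcases eq_or_ne z 0 with h | h
  · subst h
    rw [ContinuousWithinAt, mul_zero]
    refine squeeze_zero_norm' (a := fun z : ℂ => M * ‖z‖) ?_ ?_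
    · filter_upwards [self_mem_nhdsWithin] with w hw using hbd w hw
    · have : Tendsto (fun z : ℂ => M * ‖z‖) (𝓝 0) (𝓝 (M * ‖(0 : ℂ)‖)) :=
        (continuous_const.mul continuous_norm).tendsto 0
      simpa using this.mono_left nhdsWithin_le_nhds
  · refine ContinuousWithinAt.mul ?_ continuousWithinAt_id
    have hc : ContinuousWithinAt (fun z : ℂ => (z⁻¹).re - 1) (spectrum ℂ (resolvent H) \ {0}) z :=
      ((Complex.continuous_re.continuousAt.comp
        (continuousAt_inv₀ h)).sub continuousAt_const).continuousWithinAt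
    have hd : ContinuousWithinAt (fun z : ℂ => f ((z⁻¹).re - 1))
        (spectrum ℂ (resolvent H) \ {0}) z :=
      ContinuousWithinAt.comp (g := f) (t := Ici 0) (hf _ (hnn z hz h)) hc
        (fun w hw => hnn w hw.1 hw.2)
    refine hd.mono_of_mem_nhdsWithin ?_
    exact inter_mem self_mem_nhdsWithin
      (mem_nhdsWithin_of_mem_nhds (isOpen_compl_singleton.mem_nhds h))

lemma norm_damped_apply_le (hH : IsNonnegSelfAdjoint H) {f : ℝ → ℂ}
    (hf : ContinuousOn f (Ici 0)) {M : ℝ} (hM : ∀ x, 0 ≤ x → ‖f x‖ ≤ M) (v : E) :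
    ‖damped H f v‖ ≤ M * ‖resolvent H v‖ := by
  have hM0 : 0 ≤ M := (norm_nonneg _).trans (hM 0 le_rfl)
  have hsa : IsSelfAdjoint (resolvent H) := (resolvent_nonneg hH).isSelfAdjoint
  have hn : IsStarNormal (resolvent H) := hsa.isStarNormal
  have hc := continuousOn_damped hH hf hM
  set g : ℂ → ℂ := fun z => f ((z⁻¹).re - 1) * z with hg
  have hbd : ∀ z ∈ spectrum ℂ (resolvent H), ‖g z‖ ≤ M * ‖z‖ := by
    intro z hz
    obtain ⟨h1, h2⟩ := spectrum_resolvent hH hz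
    obtain ⟨hre, him⟩ := Complex.nonneg_iff.mp h1
    rcases eq_or_ne z 0 with h | h
    · simp [hg, h]
    · have hzr : z = (z.re : ℂ) := Complex.ext rfl (by simpa using him.symm)
      have hpos : 0 < z.re := lt_of_le_of_ne hre (fun h' => h (by rw [hzr, ← h']; simp))
      have : 0 ≤ (z⁻¹).re - 1 := by
        rw [hzr, ← Complex.ofReal_inv, Complex.ofReal_re, sub_nonneg]
        exact (one_le_inv₀ hpos).mpr h2
      rw [hg, norm_mul]
      exact mul_le_mul_of_nonneg_right (hM _ this) (norm_nonneg z)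
  have hle : star (damped H f) * damped H f ≤
      star ((M : ℂ) • resolvent H) * ((M : ℂ) • resolvent H) := by
    have e1 : star (damped H f) * damped H f = cfc (fun z => star (g z) * g z) (resolvent H) := by
      rw [damped, ← cfc_star, ← cfc_mul _ _ _ hc.star hc]
    have e2 : star ((M : ℂ) • resolvent H) * ((M : ℂ) • resolvent H) =
        cfc (fun z : ℂ => star ((M : ℂ) * z) * ((M : ℂ) * z)) (resolvent H) := by
      rw [cfc_mul (fun z : ℂ => star ((M : ℂ) * z)) (fun z : ℂ => (M : ℂ) * z) (resolvent H)
        (by fun_prop) (by fun_prop), cfc_star (fun z : ℂ => (M : ℂ) * z),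
        cfc_const_mul_id (M : ℂ) (resolvent H) hn]
    rw [e1, e2]
    refine cfc_mono ?_ (hc.star.mul hc) (by fun_prop)
    intro z hz
    have a1 : ∀ w : ℂ, star w * w = ((‖w‖ ^ 2 : ℝ) : ℂ) := by
      intro w
      rw [Complex.star_def, Complex.conj_mul']
      norm_cast
    have a2 : ‖(M : ℂ) * z‖ = M * ‖z‖ := by
      rw [norm_mul, Complex.norm_real, Real.norm_of_nonneg hM0]
    rw [a1, a1, Complex.real_le_real, a2]
    exact pow_le_pow_left₀ (norm_nonneg _) (hbd z hz) 2
  have hpos := ((ContinuousLinearMap.le_def _ _).mp hle).re_inner_nonneg_right v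
  have b1 : ∀ T : E →L[ℂ] E, inner ℂ v ((star T * T) v) = ((‖T v‖ ^ 2 : ℝ) : ℂ) := by
    intro T
    rw [ContinuousLinearMap.star_eq_adjoint, mul_apply_eq_comp,
      ContinuousLinearMap.adjoint_inner_right, inner_self_eq_norm_sq_to_K]
    norm_cast
  rw [sub_apply, inner_sub_right, b1, b1, map_sub] at hpos
  have hfin : ‖damped H f v‖ ^ 2 ≤ ‖((M : ℂ) • resolvent H) v‖ ^ 2 := sub_nonneg.mp hpos
  have := le_of_sq_le_sq hfin (norm_nonneg _)
  simpa [norm_smul, abs_of_nonneg hM0] using this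

/-- The defining property of `f(H)`. -/
lemma funcCalc_resolvent (hH : IsNonnegSelfAdjoint H) {f : ℝ → ℂ}
    (hf : ContinuousOn f (Ici 0)) {M : ℝ} (hM : ∀ x, 0 ≤ x → ‖f x‖ ≤ M) (v : E) :
    funcCalc H f (resolvent H v) = damped H f v :=
  LinearMap.extendOfNorm_eq hH.denseRange_resolvent ⟨M, norm_damped_apply_le hH hf hM⟩ v

lemma norm_funcCalc_le (hH : IsNonnegSelfAdjoint H) {f : ℝ → ℂ}
    (hf : ContinuousOn f (Ici 0)) {M : ℝ} (hM : ∀ x, 0 ≤ x → ‖f x‖ ≤ M) :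
    ‖funcCalc H f‖ ≤ M :=
  LinearMap.opNorm_extendOfNorm_le hH.denseRange_resolvent ((norm_nonneg _).trans (hM 0 le_rfl))
    (norm_damped_apply_le hH hf hM)

/-- The function `ψ_m(x) = x^m e^{-x}`. -/
def psi (m : ℕ) (x : ℝ) : ℝ := x ^ m * Real.exp (-x)

/-- The operator `ψ_m(aH)`. -/
def psiOp (H : E →ₗ.[ℂ] E) (m : ℕ) (a : ℝ) : E →L[ℂ] E :=
  funcCalc H fun x => (psi m (a * x) : ℂ)

/-- The heat semigroup `e^{-tH}`. -/
def heatOp (H : E →ₗ.[ℂ] E) (t : ℝ) : E →L[ℂ] E :=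
  funcCalc H fun x => (Real.exp (-(t * x)) : ℂ)

/-- The wave propagator `cos(s√H)`. -/
def waveOp (H : E →ₗ.[ℂ] E) (s : ℝ) : E →L[ℂ] E :=
  funcCalc H fun x => (Real.cos (s * √x) : ℂ)

/-- The Schrödinger group `e^{itH}`. -/
def schrodingerOp (H : E →ₗ.[ℂ] E) (t : ℝ) : E →L[ℂ] E :=
  funcCalc H fun x => Complex.exp (Complex.I * (t * x : ℝ))

end Operator

/-! ### The metric measure space -/

section Space

variable {X : Type*} [MetricSpace X] [MeasurableSpace X]

/-- Ahlfors regularity of dimension `d`: `c r^d ≤ μ(B(x, r)) ≤ C r^d` for all `x` and all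
`0 < r < diam X`. -/
def AhlforsRegular (μ : Measure X) (d : ℝ) : Prop :=
  ∃ c C : ℝ, 0 < c ∧ 0 < C ∧
    ∀ (x : X) (r : ℝ), 0 < r → ENNReal.ofReal r < Metric.ediam (univ : Set X) →
      ENNReal.ofReal (c * r ^ d) ≤ μ (Metric.ball x r) ∧
        μ (Metric.ball x r) ≤ ENNReal.ofReal (C * r ^ d)

/-- The norm `‖T‖_{L²(U) → L²(V)}` of an operator `T` on `L²(X, μ)`, that is, the supremum of
`‖T f‖_{L²(V)}` over the `f` in the unit ball of `L²` that vanish outside `U`. -/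
def localNorm {μ : Measure X} (T : Lp ℂ 2 μ →L[ℂ] Lp ℂ 2 μ) (U V : Set X) : ℝ≥0∞ :=
  ⨆ (f : Lp ℂ 2 μ) (_ : ∀ᵐ x ∂μ, x ∉ U → f x = 0) (_ : ‖f‖ ≤ 1), eLpNorm (T f) 2 (μ.restrict V)

/-- `T` is the integral operator with kernel `k`. -/
def IsKernel {μ : Measure X} (T : Lp ℂ 2 μ →L[ℂ] Lp ℂ 2 μ) (k : X → X → ℂ) : Prop :=
  AEStronglyMeasurable (Function.uncurry k) (μ.prod μ) ∧
    ∀ f : Lp ℂ 2 μ, ∀ᵐ x ∂μ,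
      Integrable (fun y => k x y * f y) μ ∧ T f x = ∫ y, k x y * f y ∂μ

/-- The on-diagonal upper estimate for the heat kernel: `e^{-tH}` has a kernel `p_t` with
`p_t(x, x) ≤ C / μ(B(x, √t))` for all `t > 0` and almost every `x`. As a kernel is only defined up to
null sets of `X × X`, its diagonal values are those given by the semigroup property,
`p_t(x, x) = ∫ |p_{t/2}(x, y)|² dμ(y)`. -/
def HeatKernelDiagonalEstimate {μ : Measure X} (H : Lp ℂ 2 μ →ₗ.[ℂ] Lp ℂ 2 μ) : Prop :=
  ∃ (C : ℝ) (p : ℝ → X → X → ℂ), 0 < C ∧ ∀ t : ℝ, 0 < t →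
    IsKernel (heatOp H t) (p t) ∧
      ∀ᵐ x ∂μ, ∫⁻ y, ‖p (t / 2) x y‖ₑ ^ 2 ∂μ ≤ ENNReal.ofReal C / μ (Metric.ball x √t)

/-- The Davies–Gaffney estimates
`‖e^{-tH}‖_{L²(U) → L²(V)} ≤ C exp(-d(U, V)² / 4t)`, where `d(U, V)` is the distance of the
sets `U` and `V`. -/
def DaviesGaffney {μ : Measure X} (H : Lp ℂ 2 μ →ₗ.[ℂ] Lp ℂ 2 μ) : Prop :=
  ∃ C : ℝ, 0 < C ∧ ∀ U V : Set X, MeasurableSet U → MeasurableSet V → ∀ t : ℝ, 0 < t →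
    localNorm (heatOp H t) U V ≤
      ENNReal.ofReal (C * Real.exp (-(sInf (image2 dist U V)) ^ 2 / (4 * t)))

/-- The dispersion property of the wave propagator with parameters `κ ∈ (0, ∞]` and `m`:
`‖cos(s√H) ψ_m(r²H)‖_{L²(B) → L²(B')} ≤ C (r / (r + s))^{(d - 1) / 2}` for all `0 < s < κ` and
any two balls `B`, `B'` of radius `r > 0`. -/
def HasWaveDispersion {μ : Measure X} (H : Lp ℂ 2 μ →ₗ.[ℂ] Lp ℂ 2 μ) (d : ℝ) (κ : ℝ≥0∞) (m : ℕ) :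
    Prop :=
  ∃ C : ℝ, 0 < C ∧ ∀ s : ℝ, 0 < s → ENNReal.ofReal s < κ → ∀ r : ℝ, 0 < r → ∀ x y : X,
    localNorm (waveOp H s ∘L psiOp H m (r ^ 2)) (Metric.ball x r) (Metric.ball y r) ≤
      ENNReal.ofReal (C * (r / (r + s)) ^ ((d - 1) / 2))

end Space

end WaveDispersion

end

namespace WaveDispersion

/-! ### Algebra and integration in the functional calculus. -/

section Calculus

variable {E : Type*} [NormedAddCommGroup E] [InnerProductSpace ℂ E] [CompleteSpace E]
  {H : E →ₗ.[ℂ] E}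

/-! The Schrödinger group is the heat semigroup at complex time, and the Fourier transform of a
Gaussian writes e^{-zH} as a multiple of z^{-1/2} ∫ cos(s√H) e^{-s²/(4z)} ds. With z = a - it, and
one further factor ψ_{m₀}(aH), dispersion of the wave propagator on balls of radius √a supplies the
decay (√a/(√a+s))^p with p = (d-1)/2.

Used as it stands, the formula loses too much near s = 0, where the wave propagator has not yet
dispersed. It is therefore applied to a^n H^n e^{-zH} with n ≥ p. Integrating by parts 2n times puts
a Hermite-type polynomial of degree 2n in s/√|z| under the integral, and the prefactor (a/|z|)^n
makes small s harmless. For a ≤ |t| what remains lives at s ~ |t|/√a, where the weight is about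
(a/|t|)^p. Together with z^{-1/2} and the length |t|/√a of the Gaussian this gives (a/|t|)^{p-1/2} =
(a/|t|)^{(d-2)/2}. This is `funcCalc_transmutation`, `transmutation_integrand_le` and
`exists_norm_schrodingerPsi_le`.

The power of H obtained in this way is m₀ + n, which may be too large. Since x^M e^{-Ax} = ∫_A^∞
x^{M+1} e^{-vx} dv, powers can be lowered one at a time as long as M > (d-2)/2
(`norm_schrodingerPsi_descend`).

The two cutoffs ψ_{m'}(h²H) and ψ_m(r²H) merge into one at scale A = h² + r², with a scalar factor
which for m ≥ d/2 turns (A/|t|)^{(d-2)/2} into r^d |t|^{-(d-2)/2} h^{-2} (`scale_factor_le`). Since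
√(A/2) ≥ r/2, the estimate holds on balls of radius r/2, and a covering argument passes to radius r.
Radii comparable to a finite diameter are handled by the trivial L² bound.

If κ is finite, nothing is assumed for s ≥ κ. There the L² bound is used, and half of the Gaussian,
held back for this purpose, beats the missing decay because |t| ≤ h^{1+ε} (`exists_one_le_weight`).
-/

lemma inv_sub_one_nonneg (hH : IsNonnegSelfAdjoint H) {z : ℂ}
    (hz : z ∈ spectrum ℂ (resolvent H)) (h0 : z ≠ 0) : 0 ≤ (z⁻¹).re - 1 := by
  obtain ⟨h1, h2⟩ := spectrum_resolvent hH hz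
  obtain ⟨hre, him⟩ := Complex.nonneg_iff.mp h1
  have hzr : z = (z.re : ℂ) := Complex.ext rfl (by simpa using him.symm)
  have hpos : 0 < z.re := lt_of_le_of_ne hre (fun h => h0 (by rw [hzr, ← h]; simp))
  rw [hzr, ← Complex.ofReal_inv, Complex.ofReal_re, sub_nonneg]
  exact (one_le_inv₀ hpos).mpr h2

lemma ext_on_resolvent (hH : IsNonnegSelfAdjoint H) {S T : E →L[ℂ] E}
    (h : ∀ v, S (resolvent H v) = T (resolvent H v)) : S = T := by
  ext v
  exact congrFun (hH.denseRange_resolvent.equalizer S.continuous T.continuous (funext h)) v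

lemma damped_congr (hH : IsNonnegSelfAdjoint H) {f g : ℝ → ℂ} (h : ∀ x, 0 ≤ x → f x = g x) :
    damped H f = damped H g := by
  refine cfc_congr fun z hz => ?_
  rcases eq_or_ne z 0 with h0 | h0
  · simp [h0]
  · simp only [h _ (inv_sub_one_nonneg hH hz h0)]

lemma funcCalc_congr (hH : IsNonnegSelfAdjoint H) {f g : ℝ → ℂ} (h : ∀ x, 0 ≤ x → f x = g x) :
    funcCalc H f = funcCalc H g := by
  rw [funcCalc, funcCalc, damped_congr hH h]

lemma funcCalc_const_mul (hH : IsNonnegSelfAdjoint H) {f : ℝ → ℂ} (hf : ContinuousOn f (Ici 0))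
    {M : ℝ} (hM : ∀ x, 0 ≤ x → ‖f x‖ ≤ M) (c : ℂ) :
    funcCalc H (fun x => c * f x) = c • funcCalc H f := by
  refine ext_on_resolvent hH fun v => ?_
  rw [smul_apply, funcCalc_resolvent hH hf hM,
    funcCalc_resolvent hH (f := fun x => c * f x) (continuousOn_const.mul hf) (M := ‖c‖ * M)]
  · rw [damped, damped, ← smul_apply,
      ← cfc_const_mul c _ _ (continuousOn_damped hH hf hM)]
    simp only [mul_assoc]
  · intro x hx
    rw [norm_mul]
    exact mul_le_mul_of_nonneg_left (hM x hx) (norm_nonneg c)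

lemma damped_resolvent_comm (hH : IsNonnegSelfAdjoint H) (g : ℝ → ℂ) (v : E) :
    damped H g (resolvent H v) = resolvent H (damped H g v) := by
  have hn : IsStarNormal (resolvent H) := (resolvent_nonneg hH).isSelfAdjoint.isStarNormal
  have h : Commute (damped H g) (resolvent H) := by
    have := cfc_commute_cfc (fun z : ℂ => g ((z⁻¹).re - 1) * z) id (resolvent H)
    rwa [cfc_id ℂ (resolvent H)] at this
  exact congrArg (fun T : E →L[ℂ] E => T v) h.eq

/-- With R = (1 + H)⁻¹ and z the spectral variable of R, both products correspond to f g z², so they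
agree on the range of R². That range is dense, which takes the density of the range of R twice. -/
lemma funcCalc_mul (hH : IsNonnegSelfAdjoint H) {f g : ℝ → ℂ} (hf : ContinuousOn f (Ici 0))
    (hg : ContinuousOn g (Ici 0)) {M N : ℝ} (hM : ∀ x, 0 ≤ x → ‖f x‖ ≤ M)
    (hN : ∀ x, 0 ≤ x → ‖g x‖ ≤ N) :
    funcCalc H (fun x => f x * g x) = funcCalc H f ∘L funcCalc H g := by
  have hfg : ∀ x, 0 ≤ x → ‖f x * g x‖ ≤ M * N := by
    intro x hx
    rw [norm_mul]
    exact mul_le_mul (hM x hx) (hN x hx) (norm_nonneg _) ((norm_nonneg _).trans (hM x hx))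
  have hn : IsStarNormal (resolvent H) := (resolvent_nonneg hH).isSelfAdjoint.isStarNormal
  have key : damped H (fun x => f x * g x) * resolvent H = damped H f * damped H g := by
    rw [damped, damped, damped, ← cfc_mul _ _ _ (continuousOn_damped hH hf hM)
      (continuousOn_damped hH hg hN)]
    have := cfc_mul (fun z : ℂ => f ((z⁻¹).re - 1) * g ((z⁻¹).re - 1) * z) id (resolvent H)
      (continuousOn_damped hH (f := fun x => f x * g x) (hf.mul hg) hfg) continuousOn_id
    rw [cfc_id ℂ (resolvent H)] at this
    rw [← this]
    refine cfc_congr fun z _ => ?_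
    simp only [id]
    ring
  refine ext_on_resolvent hH fun v => ?_
  revert v
  have : ∀ v, (funcCalc H (fun x => f x * g x) ∘L resolvent H) (resolvent H v) =
      (funcCalc H f ∘L funcCalc H g ∘L resolvent H) (resolvent H v) := by
    intro v
    simp only [ContinuousLinearMap.comp_apply]
    rw [funcCalc_resolvent hH hg hN, funcCalc_resolvent hH (f := fun x => f x * g x) (hf.mul hg) hfg, damped_resolvent_comm hH g,
      funcCalc_resolvent hH hf hM]
    exact congrArg (fun T : E →L[ℂ] E => T v) key
  intro v
  exact congrArg (fun T : E →L[ℂ] E => T v) (ext_on_resolvent hH this)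

/-- The damping factor z makes the integrand jointly continuous on S times the spectrum of R, so the
integral commutes with the continuous functional calculus of R. This gives the claim on the range of
R, and dominated convergence extends it to all vectors. The identity is stated on vectors because s
↦ f_s(H) need not be continuous in operator norm. -/
lemma funcCalc_setIntegral (hH : IsNonnegSelfAdjoint H) {S : Set ℝ} (hS : MeasurableSet S)
    {f : ℝ → ℝ → ℂ} {b : ℝ → ℝ} (hf : ContinuousOn (Function.uncurry f) (S ×ˢ Ici 0))
    (hb : ContinuousOn b S) (hfb : ∀ s ∈ S, ∀ x, 0 ≤ x → ‖f s x‖ ≤ b s)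
    (hint : IntegrableOn b S) (v : E) :
    funcCalc H (fun x => ∫ s in S, f s x) v = ∫ s in S, funcCalc H (f s) v := by
  have hn : IsStarNormal (resolvent H) := (resolvent_nonneg hH).isSelfAdjoint.isStarNormal
  have hfs : ∀ s ∈ S, ContinuousOn (f s) (Ici 0) := fun s hs =>
    hf.comp (Continuous.prodMk_right s).continuousOn fun x hx => ⟨hs, hx⟩
  have hfx : ∀ x, 0 ≤ x → ContinuousOn (fun s => f s x) S := fun x hx =>
    hf.comp (Continuous.prodMk_left x).continuousOn fun s hs => ⟨hs, hx⟩
  have hb0 : ∀ s ∈ S, 0 ≤ b s := fun s hs => (norm_nonneg _).trans (hfb s hs 0 le_rfl)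
  -- joint continuity of the damped functions
  set F : ℝ → ℂ → ℂ := fun s z => f s ((z⁻¹).re - 1) * z with hF
  have hFb : ∀ s ∈ S, ∀ z ∈ spectrum ℂ (resolvent H), ‖F s z‖ ≤ b s * ‖z‖ := by
    intro s hs z hz
    rcases eq_or_ne z 0 with h | h
    · simp [hF, h]
    · rw [hF, norm_mul]
      exact mul_le_mul_of_nonneg_right (hfb s hs _ (inv_sub_one_nonneg hH hz h)) (norm_nonneg z)
  have hFc : ContinuousOn (Function.uncurry F) (S ×ˢ spectrum ℂ (resolvent H)) := by
    rintro ⟨s, z⟩ ⟨hs, hz⟩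
    simp only at hs hz
    rcases eq_or_ne z 0 with h | h
    · subst h
      have e0 : Function.uncurry F (s, 0) = 0 := by simp [Function.uncurry, hF]
      rw [ContinuousWithinAt, e0]
      -- At z = 0 the integrand is controlled only by b(s)|z|. Continuity of b makes this bound tend
      -- to zero jointly in s and z.
      refine squeeze_zero_norm' (a := fun w : ℝ × ℂ => b w.1 * ‖w.2‖) ?_ ?_
      · filter_upwards [self_mem_nhdsWithin] with w hw using hFb _ hw.1 _ hw.2
      · have h1 : ContinuousWithinAt (fun w : ℝ × ℂ => b w.1 * ‖w.2‖)
            (S ×ˢ spectrum ℂ (resolvent H)) (s, 0) := by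
          refine ContinuousWithinAt.mul ?_ (by fun_prop)
          exact ContinuousWithinAt.comp (t := S) (hb s hs) continuousWithinAt_fst
            (fun w hw => hw.1)
        have h2 := h1.tendsto
        simpa using h2
    · have hd : ContinuousWithinAt (Function.uncurry F)
          (S ×ˢ (spectrum ℂ (resolvent H) \ {0})) (s, z) := by
        refine ContinuousWithinAt.mul ?_ (by fun_prop)
        refine ContinuousWithinAt.comp (g := Function.uncurry f) (t := S ×ˢ Ici 0)
          (f := fun w : ℝ × ℂ => (w.1, ((w.2)⁻¹).re - 1))
          (hf _ ⟨hs, inv_sub_one_nonneg hH hz h⟩) ?_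
          (fun w hw => ⟨hw.1, inv_sub_one_nonneg hH hw.2.1 hw.2.2⟩)
        refine ContinuousWithinAt.prodMk (by fun_prop) ?_
        refine ContinuousWithinAt.sub ?_ continuousWithinAt_const
        refine Complex.continuous_re.continuousAt.comp_continuousWithinAt ?_
        exact ((continuousAt_inv₀ h).comp (x := ((s, z) : ℝ × ℂ)) (f := Prod.snd)
          continuousAt_snd).continuousWithinAt
      refine hd.mono_of_mem_nhdsWithin ?_
      have h3 : {w : ℝ × ℂ | w.2 ≠ 0} ∈ 𝓝 ((s, z) : ℝ × ℂ) :=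
        (isOpen_ne_fun continuous_snd continuous_const).mem_nhds h
      filter_upwards [self_mem_nhdsWithin, mem_nhdsWithin_of_mem_nhds h3] with w h1 h2
      exact ⟨h1.1, h1.2, h2⟩
  have hbge : ∀ᵐ s ∂(volume.restrict S), ∀ z ∈ spectrum ℂ (resolvent H), ‖F s z‖ ≤ b s := by
    filter_upwards [ae_restrict_mem hS] with s hs z hz
    refine (hFb s hs z hz).trans (mul_le_of_le_one_right (hb0 s hs) ?_)
    obtain ⟨h1, h2⟩ := spectrum_resolvent hH hz
    rwa [← Complex.re_eq_norm.mpr h1]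
  have hdint : IntegrableOn (fun s => damped H (f s)) S :=
    integrableOn_cfc hS F b (resolvent H) hFc hbge hint.2 hn
  have hdeq : damped H (fun x => ∫ s in S, f s x) = ∫ s in S, damped H (f s) := by
    have := cfc_setIntegral hS F b (resolvent H) hFc hbge hint.2 hn
    rw [damped]
    simp only [hF, integral_mul_const] at this
    exact this
  -- the integrated function
  have hgc : ContinuousOn (fun x => ∫ s in S, f s x) (Ici 0) := by
    refine continuousOn_of_dominated (bound := b) ?_ ?_ hint ?_
    · intro x hx
      exact (hfx x hx).aestronglyMeasurable hS
    · intro x hx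
      filter_upwards [ae_restrict_mem hS] with s hs using hfb s hs x hx
    · filter_upwards [ae_restrict_mem hS] with s hs using hfs s hs
  have hgb : ∀ x, 0 ≤ x → ‖∫ s in S, f s x‖ ≤ ∫ s in S, b s := by
    intro x hx
    refine norm_integral_le_of_norm_le hint ?_
    filter_upwards [ae_restrict_mem hS] with s hs using hfb s hs x hx
  -- density
  have hv : v ∈ closure (range (resolvent H)) := hH.denseRange_resolvent v
  obtain ⟨y, hy, hyv⟩ := mem_closure_iff_seq_limit.mp hv
  choose w hw using hy
  obtain ⟨B, hB⟩ := hyv.norm.bddAbove_range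
  have hl : Tendsto (fun n => funcCalc H (fun x => ∫ s in S, f s x) (y n)) atTop
      (𝓝 (funcCalc H (fun x => ∫ s in S, f s x) v)) :=
    ((funcCalc H _).continuous.tendsto v).comp hyv
  have hr : Tendsto (fun n => ∫ s in S, funcCalc H (f s) (y n)) atTop
      (𝓝 (∫ s in S, funcCalc H (f s) v)) := by
    refine tendsto_integral_of_dominated_convergence (fun s => b s * B) ?_ (hint.mul_const B) ?_ ?_
    · intro n
      have h1 : IntegrableOn (fun s => damped H (f s) (w n)) S :=
        hdint.apply_continuousLinearMap (w n)
      refine h1.1.congr ?_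
      filter_upwards [ae_restrict_mem hS] with s hs
      rw [← hw, funcCalc_resolvent hH (hfs s hs) (hfb s hs)]
    · intro n
      filter_upwards [ae_restrict_mem hS] with s hs
      refine ((funcCalc H (f s)).le_opNorm _).trans ?_
      exact mul_le_mul (norm_funcCalc_le hH (hfs s hs) (hfb s hs)) (hB ⟨n, rfl⟩) (norm_nonneg _)
        (hb0 s hs)
    · exact ae_of_all _ fun s => ((funcCalc H (f s)).continuous.tendsto v).comp hyv
  refine tendsto_nhds_unique hl (hr.congr fun n => ?_)
  rw [← hw, funcCalc_resolvent hH hgc hgb, hdeq, ContinuousLinearMap.integral_apply hdint]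
  refine setIntegral_congr_fun hS fun s hs => ?_
  exact funcCalc_resolvent hH (hfs s hs) (hfb s hs) _

end Calculus

/-! ### Hermite-type polynomials and Fourier transforms of complex Gaussians. -/

section Gauss

lemma one_add_pow_mul_gauss_le {b : ℝ} (hb : 0 < b) (N : ℕ) (u : ℝ) :
    (1 + |u|) ^ N * Real.exp (-(b * u ^ 2)) ≤
      N.factorial * Real.exp (1 + 1 / (2 * b)) * Real.exp (-(b / 2) * u ^ 2) := by
  have h1 := Real.pow_div_factorial_le_exp (x := 1 + |u|) (by positivity) N
  rw [div_le_iff₀ (by positivity)] at h1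
  have h2 : |u| ≤ 1 / (2 * b) + b / 2 * u ^ 2 := by
    rw [← sq_abs u]
    have : 0 ≤ b / 2 * (|u| - 1 / b) ^ 2 := by positivity
    have e : b / 2 * (|u| - 1 / b) ^ 2 = b / 2 * |u| ^ 2 - |u| + 1 / (2 * b) := by
      field_simp
      ring
    linarith
  calc (1 + |u|) ^ N * Real.exp (-(b * u ^ 2))
      ≤ (Real.exp (1 + |u|) * N.factorial) * Real.exp (-(b * u ^ 2)) := by gcongr
    _ = N.factorial * Real.exp (1 + |u| + -(b * u ^ 2)) := by rw [Real.exp_add (1 + |u|)]; ring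
    _ ≤ N.factorial * Real.exp (1 + 1 / (2 * b) + -(b / 2) * u ^ 2) := by
        refine mul_le_mul_of_nonneg_left (Real.exp_le_exp.mpr ?_) (by positivity)
        linarith
    _ = _ := by rw [Real.exp_add (1 + 1 / (2 * b))]; ring

lemma integrable_one_add_pow_mul_gauss {b : ℝ} (hb : 0 < b) (N : ℕ) :
    Integrable fun u : ℝ => (1 + |u|) ^ N * Real.exp (-(b * u ^ 2)) := by
  refine ((integrable_exp_neg_mul_sq (half_pos hb)).const_mul
    (N.factorial * Real.exp (1 + 1 / (2 * b)))).mono' (by fun_prop) (ae_of_all _ fun u => ?_)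
  rw [Real.norm_of_nonneg (by positivity)]
  exact one_add_pow_mul_gauss_le hb N u

lemma exists_norm_eval_le (q : Polynomial ℂ) {N : ℕ} (hN : q.natDegree ≤ N) :
    ∃ C : ℝ, 0 < C ∧ ∀ w : ℂ, ‖q.eval w‖ ≤ C * (1 + ‖w‖) ^ N := by
  refine ⟨∑ i ∈ Finset.range (q.natDegree + 1), ‖q.coeff i‖ + 1, by positivity, fun w => ?_⟩
  rw [Polynomial.eval_eq_sum_range]
  refine (norm_sum_le _ _).trans ?_
  have h : ∀ i ∈ Finset.range (q.natDegree + 1), ‖q.coeff i * w ^ i‖ ≤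
      ‖q.coeff i‖ * (1 + ‖w‖) ^ N := by
    intro i hi
    rw [norm_mul, norm_pow]
    gcongr
    calc ‖w‖ ^ i ≤ (1 + ‖w‖) ^ i := by gcongr; linarith
      _ ≤ (1 + ‖w‖) ^ N := by
        refine pow_le_pow_right₀ (by linarith [norm_nonneg w]) ?_
        have := Finset.mem_range.mp hi
        omega
  refine (Finset.sum_le_sum h).trans ?_
  rw [← Finset.sum_mul]
  gcongr
  linarith

lemma norm_cexp_gauss (b : ℂ) (s : ℝ) :
    ‖Complex.exp (-b * (s : ℂ) ^ 2)‖ = Real.exp (-(b.re * s ^ 2)) := by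
  rw [Complex.norm_exp]
  congr 1
  rw [← Complex.ofReal_pow, neg_mul, Complex.neg_re, Complex.re_mul_ofReal]

lemma integrable_eval_mul_gauss (q : Polynomial ℂ) {b : ℂ} (hb : 0 < b.re) (β : ℂ) :
    Integrable fun s : ℝ => q.eval (β * s) * Complex.exp (-b * (s : ℂ) ^ 2) := by
  obtain ⟨C, hC, hq⟩ := exists_norm_eval_le q le_rfl
  refine ((integrable_one_add_pow_mul_gauss hb q.natDegree).const_mul
    (C * (1 + ‖β‖) ^ q.natDegree)).mono' ?_ (ae_of_all _ fun s => ?_)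
  · exact Continuous.aestronglyMeasurable (by fun_prop)
  · rw [norm_mul, norm_cexp_gauss]
    have h1 : 1 + ‖β * s‖ ≤ (1 + ‖β‖) * (1 + |s|) := by
      rw [norm_mul, Complex.norm_real, Real.norm_eq_abs]
      nlinarith [norm_nonneg β, abs_nonneg s]
    calc ‖q.eval (β * s)‖ * Real.exp (-(b.re * s ^ 2))
        ≤ (C * ((1 + ‖β‖) * (1 + |s|)) ^ q.natDegree) * Real.exp (-(b.re * s ^ 2)) := by
          gcongr
          exact (hq _).trans (by gcongr)
      _ = _ := by rw [mul_pow]; ring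

/-- The polynomials `q_k` with `∂^k e^{-x²} = q_k(x) e^{-x²}`. -/
noncomputable def gaussPoly : ℕ → Polynomial ℂ
  | 0 => 1
  | k + 1 => (gaussPoly k).derivative - 2 * Polynomial.X * gaussPoly k

lemma natDegree_gaussPoly_le (k : ℕ) : (gaussPoly k).natDegree ≤ k := by
  induction k with
  | zero => simp [gaussPoly]
  | succ k ih =>
    rw [gaussPoly]
    refine (Polynomial.natDegree_sub_le _ _).trans (max_le ?_ ?_)
    · exact (Polynomial.natDegree_derivative_le _).trans (by omega)
    · refine Polynomial.natDegree_mul_le.trans ?_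
      have : (2 * Polynomial.X : Polynomial ℂ).natDegree ≤ 1 := by
        compute_degree
      omega

lemma hasDerivAt_gaussPoly (k : ℕ) {b β : ℂ} (hβ : β ^ 2 = b) (s : ℝ) :
    HasDerivAt (fun s : ℝ => (gaussPoly k).eval (β * s) * Complex.exp (-b * (s : ℂ) ^ 2))
      (β * ((gaussPoly (k + 1)).eval (β * s) * Complex.exp (-b * (s : ℂ) ^ 2))) s := by
  have h0 : HasDerivAt (fun w : ℂ => (gaussPoly k).eval (β * w) * Complex.exp (-b * w ^ 2))
      (β * ((gaussPoly (k + 1)).eval (β * s) * Complex.exp (-b * (s : ℂ) ^ 2))) (s : ℂ) := by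
    have h1 : HasDerivAt (fun w : ℂ => (gaussPoly k).eval (β * w))
        ((gaussPoly k).derivative.eval (β * s) * (β * 1)) (s : ℂ) :=
      ((gaussPoly k).hasDerivAt (β * s)).comp (s : ℂ) ((hasDerivAt_id (s : ℂ)).const_mul β)
    have h2 : HasDerivAt (fun w : ℂ => Complex.exp (-b * w ^ 2))
        (Complex.exp (-b * (s : ℂ) ^ 2) * (-b * (2 * (s : ℂ)))) (s : ℂ) := by
      have := (((hasDerivAt_pow 2 (s : ℂ)).const_mul (-b))).cexp
      simpa using this
    convert! h1.mul h2 using 1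
    simp only [gaussPoly, Polynomial.eval_sub, Polynomial.eval_mul, Polynomial.eval_X,
      Polynomial.eval_ofNat]
    rw [← hβ]
    ring
  exact h0.comp_ofReal

/-- Each integration by parts moves one derivative from the Gaussian to the exponential, at the
price of -iτ. The power β^k comes from the chain rule for s ↦ βs. -/
lemma integral_gaussPoly (k : ℕ) {b β : ℂ} (hb : 0 < b.re) (hβ : β ^ 2 = b) (τ : ℝ) :
    ∫ s : ℝ, (gaussPoly k).eval (β * s) * Complex.exp (-b * (s : ℂ) ^ 2) *
        Complex.exp (Complex.I * τ * s) * β ^ k =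
      (-(Complex.I * τ)) ^ k * ((Real.pi / b) ^ (1 / 2 : ℂ) *
        Complex.exp (-(τ : ℂ) ^ 2 / (4 * b))) := by
  have hnorm : ∀ s : ℝ, ‖Complex.exp (Complex.I * τ * s)‖ = 1 := by
    intro s
    have : Complex.I * τ * s = ((τ * s : ℝ) : ℂ) * Complex.I := by push_cast; ring
    rw [this, Complex.norm_exp_ofReal_mul_I]
  have hint : ∀ j, Integrable fun s : ℝ =>
      ((gaussPoly j).eval (β * s) * Complex.exp (-b * (s : ℂ) ^ 2)) *
        Complex.exp (Complex.I * τ * s) := by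
    intro j
    refine (integrable_eval_mul_gauss (gaussPoly j) hb β).mul_bdd (c := 1) ?_ ?_
    · exact Continuous.aestronglyMeasurable (by fun_prop)
    · exact ae_of_all _ fun s => (hnorm s).le
  induction k with
  | zero =>
    rw [← fourierIntegral_gaussian hb τ]
    simp only [gaussPoly, Polynomial.eval_one, one_mul, pow_zero, mul_one]
    exact integral_congr_ae (ae_of_all _ fun s => mul_comm _ _)
  | succ k ih =>
    have hd : ∀ s : ℝ, HasDerivAt (fun s : ℝ => Complex.exp (Complex.I * τ * s))
        (Complex.I * τ * Complex.exp (Complex.I * τ * s)) s := by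
      intro s
      have := ((hasDerivAt_id (s : ℂ)).const_mul (Complex.I * τ)).cexp.comp_ofReal
      simpa [mul_comm] using this
    have h := integral_mul_deriv_eq_deriv_mul_of_integrable 
      (fun s _ => hasDerivAt_gaussPoly k hβ s) (fun s _ => hd s)
      (((hint k).const_mul (Complex.I * τ)).congr (ae_of_all _ fun s => by
        simp only [Pi.mul_apply]; ring))
      (((hint (k + 1)).const_mul β).congr (ae_of_all _ fun s => by
        simp only [Pi.mul_apply]; ring)) (hint k)
    rw [pow_succ (-(Complex.I * τ)), mul_assoc, mul_comm (-(Complex.I * τ)), ← mul_assoc, ← ih,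
      ← integral_mul_const]
    have e1 : ∀ s : ℝ, (gaussPoly (k + 1)).eval (β * s) * Complex.exp (-b * (s : ℂ) ^ 2) *
        Complex.exp (Complex.I * τ * s) * β ^ (k + 1) =
        (β * ((gaussPoly (k + 1)).eval (β * s) * Complex.exp (-b * (s : ℂ) ^ 2)) *
        Complex.exp (Complex.I * τ * s)) * β ^ k := fun s => by ring
    simp only [e1]
    rw [integral_mul_const, ← neg_eq_iff_eq_neg.mpr h, neg_mul, ← integral_mul_const,
      ← integral_neg]
    exact integral_congr_ae (ae_of_all _ fun s => by ring)

/-- An even order is taken so that the results for τ and -τ coincide and average to the cosine, the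
function available from the wave propagator. -/
lemma integral_gaussPoly_cos (n : ℕ) {b β : ℂ} (hb : 0 < b.re) (hβ : β ^ 2 = b) (τ : ℝ) :
    ∫ s : ℝ, (gaussPoly (2 * n)).eval (β * s) * Complex.exp (-b * (s : ℂ) ^ 2) *
        (Real.cos (s * τ) : ℂ) * β ^ (2 * n) =
      (-1) ^ n * (τ : ℂ) ^ (2 * n) * ((Real.pi / b) ^ (1 / 2 : ℂ) *
        Complex.exp (-(τ : ℂ) ^ 2 / (4 * b))) := by
  have hint : ∀ τ : ℝ, Integrable fun s : ℝ =>
      ((gaussPoly (2 * n)).eval (β * s) * Complex.exp (-b * (s : ℂ) ^ 2)) *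
        Complex.exp (Complex.I * τ * s) * β ^ (2 * n) := by
    intro τ
    refine ((integrable_eval_mul_gauss _ hb β).mul_bdd (c := 1) ?_ ?_).mul_const _
    · exact Continuous.aestronglyMeasurable (by fun_prop)
    · refine ae_of_all _ fun s => ?_
      have : Complex.I * τ * s = ((τ * s : ℝ) : ℂ) * Complex.I := by push_cast; ring
      rw [this, Complex.norm_exp_ofReal_mul_I]
  have h1 := integral_gaussPoly (2 * n) hb hβ τ
  have h2 := integral_gaussPoly (2 * n) hb hβ (-τ)
  have e : ∀ s : ℝ, (gaussPoly (2 * n)).eval (β * s) * Complex.exp (-b * (s : ℂ) ^ 2) *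
        (Real.cos (s * τ) : ℂ) * β ^ (2 * n) =
      (1 / 2 : ℂ) * ((gaussPoly (2 * n)).eval (β * s) * Complex.exp (-b * (s : ℂ) ^ 2) *
        Complex.exp (Complex.I * τ * s) * β ^ (2 * n) +
      (gaussPoly (2 * n)).eval (β * s) * Complex.exp (-b * (s : ℂ) ^ 2) *
        Complex.exp (Complex.I * ((-τ : ℝ) : ℂ) * s) * β ^ (2 * n)) := by
    intro s
    rw [Complex.ofReal_cos, Complex.cos]
    have e1 : ((s * τ : ℝ) : ℂ) * Complex.I = Complex.I * τ * s := by push_cast; ring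
    have e2 : -((s * τ : ℝ) : ℂ) * Complex.I = Complex.I * ((-τ : ℝ) : ℂ) * s := by
      push_cast; ring
    rw [e1, e2]
    ring
  simp only [e]
  rw [integral_const_mul, integral_add (hint τ) (hint (-τ)), h1, h2]
  simp only [pow_mul, neg_sq, mul_pow, Complex.I_sq, Complex.ofReal_neg]
  ring

end Gauss

/-! ### Norms of vector integrals, and the multipliers e^{itx} ψ_M(Ax). -/

/-- Integrability of g is not required: otherwise its Bochner integral is zero and the bound is
trivial. Below, R is restriction to a ball. -/
lemma norm_apply_setIntegral_le {E F : Type*} [NormedAddCommGroup E] [NormedSpace ℂ E]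
    [CompleteSpace E] [NormedAddCommGroup F] [NormedSpace ℂ F] [CompleteSpace F] (R : E →L[ℂ] F)
    {S : Set ℝ} (hS : MeasurableSet S) {g : ℝ → E} {b : ℝ → ℝ} (h : ∀ s ∈ S, ‖R (g s)‖ ≤ b s)
    (hb : IntegrableOn b S) : ‖R (∫ s in S, g s)‖ ≤ ∫ s in S, b s := by
  by_cases hg : IntegrableOn g S
  · rw [← R.integral_comp_comm hg]
    refine norm_integral_le_of_norm_le hb ?_
    filter_upwards [ae_restrict_mem hS] with s hs using h s hs
  · rw [integral_undef hg, map_zero, norm_zero]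
    exact setIntegral_nonneg hS fun s hs => (norm_nonneg _).trans (h s hs)

lemma psi_nonneg (m : ℕ) {x : ℝ} (hx : 0 ≤ x) : 0 ≤ psi m x := by
  unfold psi
  positivity

lemma psi_le (m : ℕ) {x : ℝ} (hx : 0 ≤ x) : psi m x ≤ m.factorial := by
  have h := Real.pow_div_factorial_le_exp (x := x) hx m
  rw [div_le_iff₀ (by positivity)] at h
  rw [psi, Real.exp_neg, ← div_eq_mul_inv, div_le_iff₀ (Real.exp_pos x), mul_comm]
  exact h

lemma norm_psi_le (m : ℕ) {x : ℝ} (hx : 0 ≤ x) : ‖(psi m x : ℂ)‖ ≤ m.factorial := by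
  rw [Complex.norm_real, Real.norm_of_nonneg (psi_nonneg m hx)]
  exact psi_le m hx

@[fun_prop]
lemma continuous_psi (m : ℕ) : Continuous (psi m) := by
  unfold psi
  fun_prop

/-- The multiplier `e^{itx} ψ_M(Ax)`. -/
noncomputable def schrodingerPsi (t : ℝ) (M : ℕ) (A x : ℝ) : ℂ :=
  Complex.exp (Complex.I * (t * x : ℝ)) * (psi M (A * x) : ℂ)

lemma norm_exp_I_mul (y : ℝ) : ‖Complex.exp (Complex.I * (y : ℂ))‖ = 1 := by
  rw [mul_comm, Complex.norm_exp_ofReal_mul_I]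

lemma norm_schrodingerPsi_le (t : ℝ) (M : ℕ) {A x : ℝ} (hA : 0 ≤ A) (hx : 0 ≤ x) :
    ‖schrodingerPsi t M A x‖ ≤ M.factorial := by
  rw [schrodingerPsi, norm_mul, norm_exp_I_mul, one_mul]
  exact norm_psi_le M (mul_nonneg hA hx)

lemma continuous_schrodingerPsi (t : ℝ) (M : ℕ) :
    Continuous (Function.uncurry (schrodingerPsi t M)) := by
  unfold schrodingerPsi Function.uncurry
  fun_prop

/-! ### Pointwise bounds for the transmutation integrand. -/

section Scalar

/-- This is where n ≥ p enters. One has (η+u)² ≤ 2(1+u)(η²+u), and of the resulting n powers of η²+u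
exactly p cancel the denominator of the weight. The other n - p are at most powers of 1+u, left for
the Gaussian to absorb. -/
lemma eta_weight_le {η p u : ℝ} {n : ℕ} (hη : 0 < η) (hη1 : η ≤ 1) (hp : 0 < p) (hn : p ≤ n)
    (hu : 0 ≤ u) :
    (η + u) ^ (2 * n) * (η ^ 2 / (η ^ 2 + u)) ^ p ≤ η ^ (2 * p) * (2 ^ n * (1 + u) ^ (2 * n)) := by
  have hpos : 0 < η ^ 2 + u := by positivity
  have hη2 : η ^ 2 ≤ 1 := pow_le_one₀ hη.le hη1
  have h1 : (η + u) ^ 2 ≤ 2 * (1 + u) * (η ^ 2 + u) := by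
    nlinarith [sq_nonneg (η - u), mul_nonneg hu (sq_nonneg η)]
  have h2 : (η ^ 2 + u) ^ (n : ℝ) ≤ (1 + u) ^ (n : ℝ) * (η ^ 2 + u) ^ p := by
    have e : (n : ℝ) = (n - p) + p := by ring
    conv_lhs => rw [e]
    rw [Real.rpow_add hpos]
    gcongr
    calc (η ^ 2 + u) ^ ((n : ℝ) - p) ≤ (1 + u) ^ ((n : ℝ) - p) :=
          Real.rpow_le_rpow hpos.le (by linarith) (by linarith)
      _ ≤ (1 + u) ^ (n : ℝ) := Real.rpow_le_rpow_of_exponent_le (by linarith) (by linarith)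
  rw [Real.rpow_natCast, Real.rpow_natCast] at h2
  have h3 : (η + u) ^ (2 * n) ≤ 2 ^ n * (1 + u) ^ (2 * n) * (η ^ 2 + u) ^ p := by
    calc (η + u) ^ (2 * n) = ((η + u) ^ 2) ^ n := pow_mul _ _ _
      _ ≤ (2 * (1 + u) * (η ^ 2 + u)) ^ n := by gcongr
      _ = 2 ^ n * (1 + u) ^ n * (η ^ 2 + u) ^ n := by rw [mul_pow, mul_pow]
      _ ≤ 2 ^ n * (1 + u) ^ n * ((1 + u) ^ n * (η ^ 2 + u) ^ p) := by gcongr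
      _ = _ := by ring
  have h4 : (η ^ 2 / (η ^ 2 + u)) ^ p * (η ^ 2 + u) ^ p = η ^ (2 * p) := by
    rw [← Real.mul_rpow (by positivity) hpos.le, div_mul_cancel₀ _ hpos.ne', Real.rpow_mul hη.le,
      Real.rpow_two]
  calc (η + u) ^ (2 * n) * (η ^ 2 / (η ^ 2 + u)) ^ p
      ≤ (2 ^ n * (1 + u) ^ (2 * n) * (η ^ 2 + u) ^ p) * (η ^ 2 / (η ^ 2 + u)) ^ p := by gcongr
    _ = ((η ^ 2 / (η ^ 2 + u)) ^ p * (η ^ 2 + u) ^ p) * (2 ^ n * (1 + u) ^ (2 * n)) := by ring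
    _ = _ := by rw [h4]

/-- With `η = √a B` and `δ = √a B²`, where `B² = 1 / (4Y)`, the integrand of the transmutation
formula is at most `η^{2p}` times a Gaussian at scale `1 / δ`. -/
lemma transmutation_integrand_le {a B Y p s : ℝ} {n : ℕ} (ha : 0 < a) (hB : 0 < B)
    (hBY : B ^ 2 * (4 * Y) = 1) (haY : a ≤ Y) (hp : 0 < p) (hn : p ≤ n) (hs : 0 ≤ s) :
    a ^ n * B ^ (2 * n) * ((1 + B * s) ^ (2 * n) * Real.exp (-(a / (4 * Y ^ 2) * s ^ 2)) *
        ((√a / (√a + s)) ^ p * Real.exp (a * s ^ 2 / (8 * Y ^ 2)))) ≤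
      (√a * B) ^ (2 * p) * (2 ^ n * ((1 + √a * B ^ 2 * s) ^ (2 * n) *
        Real.exp (-(2 * (√a * B ^ 2 * s) ^ 2)))) := by
  have hra : 0 < √a := Real.sqrt_pos.mpr ha
  have hra2 : √a ^ 2 = a := Real.sq_sqrt ha.le
  have hY : 0 < Y := ha.trans_le haY
  have hη1 : √a * B ≤ 1 := by
    have : (√a * B) ^ 2 ≤ 1 ^ 2 := by
      rw [mul_pow, hra2]
      nlinarith [sq_nonneg B]
    exact le_of_sq_le_sq this zero_le_one
  have hu : 0 ≤ √a * B ^ 2 * s := by positivity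
  have h := eta_weight_le (mul_pos hra hB) hη1 hp hn hu
  have e1 : a ^ n * B ^ (2 * n) * (1 + B * s) ^ (2 * n) =
      (√a * B + √a * B ^ 2 * s) ^ (2 * n) := by
    have : √a * B + √a * B ^ 2 * s = √a * B * (1 + B * s) := by ring
    rw [this, mul_pow, mul_pow, pow_mul (√a), hra2]
  have e2 : (√a * B) ^ 2 / ((√a * B) ^ 2 + √a * B ^ 2 * s) = √a / (√a + s) := by
    have : √a + s ≠ 0 := by positivity
    have h1 : (√a * B) ^ 2 + √a * B ^ 2 * s = √a * B ^ 2 * (√a + s) := by ring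
    rw [h1]
    field_simp
  -- In the variable u = √a B² s the kernel decays like e^{-4u²} and the permitted growth is
  -- e^{2u²}, so e^{-2u²} is left.
  have e3 : Real.exp (-(a / (4 * Y ^ 2) * s ^ 2)) * Real.exp (a * s ^ 2 / (8 * Y ^ 2)) =
      Real.exp (-(2 * (√a * B ^ 2 * s) ^ 2)) := by
    rw [← Real.exp_add]
    congr 1
    have hB2 : B ^ 2 = 1 / (4 * Y) := by
      field_simp
      linarith
    rw [mul_pow, mul_pow, hra2, hB2]
    field_simp
    ring
  rw [e2] at h
  calc _ = a ^ n * B ^ (2 * n) * (1 + B * s) ^ (2 * n) * (√a / (√a + s)) ^ p *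
        (Real.exp (-(a / (4 * Y ^ 2) * s ^ 2)) * Real.exp (a * s ^ 2 / (8 * Y ^ 2))) := by ring
    _ ≤ (√a * B) ^ (2 * p) * (2 ^ n * (1 + √a * B ^ 2 * s) ^ (2 * n)) *
        Real.exp (-(2 * (√a * B ^ 2 * s) ^ 2)) := by
      rw [e1, e3]
      gcongr
    _ = _ := by ring

end Scalar

/-! ### The transmutation formula. -/

section Core

variable {E : Type*} [NormedAddCommGroup E] [InnerProductSpace ℂ E] [CompleteSpace E]
  {H : E →ₗ.[ℂ] E}

lemma waveOp_abs (hH : IsNonnegSelfAdjoint H) (s : ℝ) : waveOp H |s| = waveOp H s := by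
  refine funcCalc_congr hH fun x _ => ?_
  rw [← Real.cos_abs (s * √x), abs_mul, abs_of_nonneg (Real.sqrt_nonneg x)]

lemma norm_cos_le (y : ℝ) : ‖(Real.cos y : ℂ)‖ ≤ 1 := by
  rw [Complex.norm_real]
  exact Real.abs_cos_le_one y

lemma waveOp_comp_psiOp (hH : IsNonnegSelfAdjoint H) (s : ℝ) (m : ℕ) {a : ℝ} (ha : 0 ≤ a) :
    waveOp H s ∘L psiOp H m a =
      funcCalc H fun x => (Real.cos (s * √x) : ℂ) * (psi m (a * x) : ℂ) :=
  (funcCalc_mul hH (f := fun x => (Real.cos (s * √x) : ℂ)) (g := fun x => (psi m (a * x) : ℂ))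
    (by fun_prop) (by fun_prop) (fun _ _ => norm_cos_le _)
    (fun _ hx => norm_psi_le m (mul_nonneg ha hx))).symm

/-- With z = a - it and b = 1/(4z), the multiplier is 2^{m₀+n} ψ_{m₀}(ax) a^n x^n e^{-zx}, and the
last two factors are the cosine transform at τ = √x of the Gaussian with its polynomial. The point s
= 0 is removed because dispersion is assumed only for s > 0. -/
lemma funcCalc_transmutation (hH : IsNonnegSelfAdjoint H) (m₀ n : ℕ) {a t : ℝ} (ha : 0 < a) :
    ∃ (b β K : ℂ), b.re = a / (4 * (a ^ 2 + t ^ 2)) ∧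
      ‖β‖ ^ 2 * (4 * √(a ^ 2 + t ^ 2)) = 1 ∧
      ‖K‖ = 2 ^ (m₀ + n) * (a ^ n * ‖β‖ ^ (2 * n)) * (‖β‖ / √Real.pi) ∧
      ∀ f : E, funcCalc H (schrodingerPsi t (m₀ + n) (2 * a)) f =
        K • ∫ s in ({0}ᶜ : Set ℝ), ((gaussPoly (2 * n)).eval (β * s) *
          Complex.exp (-b * (s : ℂ) ^ 2)) • (waveOp H s ∘L psiOp H m₀ a) f := by
  set z : ℂ := a - Complex.I * t with hz
  have hzre : z.re = a := by simp [hz]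
  have hzim : z.im = -t := by simp [hz]
  have hz0 : z ≠ 0 := fun h => ha.ne' (by rw [← hzre, h, Complex.zero_re])
  have hsq : Complex.normSq z = a ^ 2 + t ^ 2 := by
    rw [Complex.normSq_apply, hzre, hzim]; ring
  have hnz : ‖z‖ = √(a ^ 2 + t ^ 2) := by rw [Complex.norm_def, hsq]
  set b : ℂ := 1 / (4 * z) with hb
  have hb0 : b ≠ 0 := by rw [hb]; positivity
  -- The branch is immaterial: only β² = b and |β| enter.
  obtain ⟨β, hβ⟩ := IsAlgClosed.exists_pow_nat_eq b (n := 2) two_pos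
  have hβ0 : β ≠ 0 := fun h => hb0 (by rw [← hβ, h]; simp)
  set c : ℂ := (Real.pi / b) ^ (1 / 2 : ℂ) with hc
  have hc2 : c ^ 2 = Real.pi / b := by
    have := Complex.cpow_nat_inv_pow (Real.pi / b) two_ne_zero
    rw [hc]
    convert! this using 3
    norm_num
  have hnb : ‖b‖ = ‖β‖ ^ 2 := by rw [← hβ, norm_pow]
  have hnc : ‖c‖ = √Real.pi / ‖β‖ := by
    have h1 : ‖c‖ ^ 2 = (√Real.pi / ‖β‖) ^ 2 := by
      rw [← norm_pow, hc2, norm_div, hnb, Complex.norm_real, Real.norm_of_nonneg Real.pi_pos.le,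
        div_pow, Real.sq_sqrt Real.pi_pos.le]
    exact (sq_eq_sq₀ (norm_nonneg _) (by positivity)).mp h1
  have hc0 : c ≠ 0 := by
    rw [← norm_pos_iff, hnc]
    have := norm_pos_iff.mpr hβ0
    positivity
  have hbre : b.re = a / (4 * (a ^ 2 + t ^ 2)) := by
    have : b = (1 / 4 : ℝ) * z⁻¹ := by rw [hb]; push_cast; field_simp
    rw [this, Complex.re_ofReal_mul, Complex.inv_re, hsq, hzre]
    field_simp
  have hbpos : 0 < b.re := by rw [hbre]; positivity
  refine ⟨b, β, 2 ^ (m₀ + n) * (a ^ n * (-1) ^ n * β ^ (2 * n)) * c⁻¹, hbre, ?_, ?_, ?_⟩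
  · rw [← hnb, ← hnz, hb]
    simp only [norm_div, norm_mul, norm_one]
    have : ‖z‖ ≠ 0 := norm_ne_zero_iff.mpr hz0
    have h4 : ‖(4 : ℂ)‖ = 4 := by norm_num
    rw [h4]
    field_simp
  · simp only [norm_mul, norm_pow, norm_inv, hnc, norm_neg, norm_one, one_pow, mul_one,
      Complex.norm_real, Real.norm_of_nonneg ha.le, inv_div]
    norm_num
  · intro f
    set g : ℝ → ℂ := fun s => (gaussPoly (2 * n)).eval (β * s) * Complex.exp (-b * (s : ℂ) ^ 2)
      with hg
    have hgc : Continuous g := by rw [hg]; fun_prop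
    have hgi : Integrable g := integrable_eval_mul_gauss _ hbpos β
    have hscalar : ∀ x : ℝ, 0 ≤ x → schrodingerPsi t (m₀ + n) (2 * a) x =
        (2 ^ (m₀ + n) * (a ^ n * (-1) ^ n * β ^ (2 * n)) * c⁻¹) * ∫ s in ({0}ᶜ : Set ℝ),
          g s * ((Real.cos (s * √x) : ℂ) * (psi m₀ (a * x) : ℂ)) := by
      intro x hx
      have h1 := integral_gaussPoly_cos n hbpos hβ (√x)
      rw [integral_mul_const] at h1
      have h2 : -((√x : ℝ) : ℂ) ^ 2 / (4 * b) = -(z * x) := by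
        rw [← Complex.ofReal_pow, Real.sq_sqrt hx, hb]
        field_simp
      have h3 : ((√x : ℝ) : ℂ) ^ (2 * n) = (x : ℂ) ^ n := by
        rw [pow_mul, ← Complex.ofReal_pow, Real.sq_sqrt hx]
      rw [h2, h3, ← hc] at h1
      rw [restrict_compl_singleton]
      simp only [← mul_assoc]
      rw [integral_mul_const]
      set J : ℂ := ∫ s : ℝ, g s * (Real.cos (s * √x) : ℂ) with hJ
      replace h1 : J * β ^ (2 * n) = (-1) ^ n * (x : ℂ) ^ n * (c * Complex.exp (-(z * x))) := h1
      have h5 : (-1 : ℂ) ^ n * (-1) ^ n = 1 := by rw [← mul_pow]; norm_num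
      have h6 : schrodingerPsi t (m₀ + n) (2 * a) x =
          2 ^ (m₀ + n) * a ^ n * (psi m₀ (a * x) : ℂ) * ((x : ℂ) ^ n * Complex.exp (-(z * x))) := by
        have e1 : Complex.exp (Complex.I * (t * x : ℝ)) * Complex.exp (-(2 * a * x : ℝ)) =
            Complex.exp (-(a * x : ℝ)) * Complex.exp (-(z * x)) := by
          rw [← Complex.exp_add, ← Complex.exp_add, hz]
          congr 1
          push_cast
          ring
        simp only [schrodingerPsi, psi]
        push_cast at e1 ⊢
        calc _ = (2 * (a : ℂ) * x) ^ (m₀ + n) *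
              (Complex.exp (Complex.I * (t * x)) * Complex.exp (-(2 * a * x))) := by ring
          _ = _ := by rw [e1]; ring
      calc schrodingerPsi t (m₀ + n) (2 * a) x
          = 2 ^ (m₀ + n) * a ^ n * (psi m₀ (a * x) : ℂ) * (x : ℂ) ^ n *
            Complex.exp (-(z * x)) * (c⁻¹ * c) * ((-1) ^ n * (-1) ^ n) := by
            rw [h6, h5, inv_mul_cancel₀ hc0]; ring
        _ = 2 ^ (m₀ + n) * a ^ n * (-1) ^ n * c⁻¹ * (psi m₀ (a * x) : ℂ) *
            ((-1) ^ n * (x : ℂ) ^ n * (c * Complex.exp (-(z * x)))) := by ring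
        _ = _ := by rw [← h1]; ring
    have hcosb : ∀ s x : ℝ, 0 ≤ x →
        ‖(Real.cos (s * √x) : ℂ) * (psi m₀ (a * x) : ℂ)‖ ≤ m₀.factorial := by
      intro s x hx
      rw [norm_mul]
      exact (mul_le_of_le_one_left (norm_nonneg _) (norm_cos_le _)).trans
        (norm_psi_le _ (mul_nonneg ha.le hx))
    have hmint := funcCalc_setIntegral hH (S := ({0}ᶜ : Set ℝ)) (measurableSet_singleton 0).compl
      (f := fun s x => g s * ((Real.cos (s * √x) : ℂ) * (psi m₀ (a * x) : ℂ)))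
      (b := fun s => ‖g s‖ * m₀.factorial) (Continuous.continuousOn (by
        unfold Function.uncurry
        fun_prop)) (by fun_prop) (by
        intro s _ x hx
        rw [norm_mul (g s)]
        exact mul_le_mul_of_nonneg_left (hcosb s x hx) (norm_nonneg _)) (hgi.norm.mul_const _).integrableOn f
    have hbint : ∀ x : ℝ, 0 ≤ x → ‖∫ s in ({0}ᶜ : Set ℝ),
        g s * ((Real.cos (s * √x) : ℂ) * (psi m₀ (a * x) : ℂ))‖ ≤
        ∫ s in ({0}ᶜ : Set ℝ), ‖g s‖ * m₀.factorial := by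
      intro x hx
      refine norm_integral_le_of_norm_le (hgi.norm.mul_const _).integrableOn (ae_of_all _ fun s => ?_)
      rw [norm_mul]
      exact mul_le_mul_of_nonneg_left (hcosb s x hx) (norm_nonneg _)
    have hcint : ContinuousOn (fun x : ℝ => ∫ s in ({0}ᶜ : Set ℝ),
        g s * ((Real.cos (s * √x) : ℂ) * (psi m₀ (a * x) : ℂ))) (Ici 0) := by
      refine continuousOn_of_dominated (bound := fun s => ‖g s‖ * m₀.factorial) ?_ ?_
        (hgi.norm.mul_const _).integrableOn ?_
      · intro x _
        exact Continuous.aestronglyMeasurable (by fun_prop)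
      · intro x hx
        refine ae_of_all _ fun s => ?_
        rw [norm_mul]
        exact mul_le_mul_of_nonneg_left (hcosb s x hx) (norm_nonneg _)
      · exact ae_of_all _ fun s => Continuous.continuousOn (by fun_prop)
    rw [funcCalc_congr hH hscalar, funcCalc_const_mul hH hcint hbint, smul_apply, hmint]
    congr 1
    refine integral_congr_ae (ae_of_all _ fun s => ?_)
    simp only
    rw [funcCalc_const_mul hH (Continuous.continuousOn (by fun_prop)) (hcosb s), smul_apply,
      waveOp_comp_psiOp hH s m₀ ha.le]

end Core

universe u

/-! ### Decay in time for large powers of H. -/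

section Core

variable {E : Type*} [NormedAddCommGroup E] [InnerProductSpace ℂ E] [CompleteSpace E]
  {H : E →ₗ.[ℂ] E}

lemma norm_apply_schrodingerPsi_le (hH : IsNonnegSelfAdjoint H) {F : Type*} [NormedAddCommGroup F]
    [NormedSpace ℂ F] {R : E →L[ℂ] F} (hR : ‖R‖ ≤ 1) {f : E} (hf : ‖f‖ ≤ 1) (t : ℝ) (M : ℕ)
    {A : ℝ} (hA : 0 ≤ A) : ‖R (funcCalc H (schrodingerPsi t M A) f)‖ ≤ M.factorial := by
  have h1 : ‖funcCalc H (schrodingerPsi t M A)‖ ≤ M.factorial :=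
    norm_funcCalc_le hH ((continuous_schrodingerPsi t M).comp
      (Continuous.prodMk_right A)).continuousOn fun x hx => norm_schrodingerPsi_le t M hA hx
  refine (R.le_of_opNorm_le hR _).trans ?_
  rw [one_mul]
  refine (ContinuousLinearMap.le_of_opNorm_le _ h1 f).trans ?_
  exact mul_le_of_le_one_right (by positivity) hf

/-- Dispersion of the wave propagator against the kernel of the transmutation formula. -/
theorem exists_norm_schrodingerPsi_le (hH : IsNonnegSelfAdjoint H) {p : ℝ} (hp : 1 / 2 < p)
    (m₀ n : ℕ) (hn : p ≤ n) {C₁ : ℝ} (hC₁ : 0 < C₁) :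
    ∃ C : ℝ, 0 < C ∧ ∀ (F : Type u) [NormedAddCommGroup F] [NormedSpace ℂ F] [CompleteSpace F]
      (R : E →L[ℂ] F), ‖R‖ ≤ 1 → ∀ f : E, ‖f‖ ≤ 1 → ∀ a t : ℝ, 0 < a → t ≠ 0 →
      (∀ s : ℝ, 0 < s → ‖R ((waveOp H s ∘L psiOp H m₀ a) f)‖ ≤
        C₁ * ((√a / (√a + s)) ^ p * Real.exp (a * s ^ 2 / (16 * t ^ 2)))) →
      ‖R (funcCalc H (schrodingerPsi t (m₀ + n) (2 * a)) f)‖ ≤ C * (a / |t|) ^ (p - 1 / 2) := by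
  obtain ⟨Cq, hCq, hq⟩ := exists_norm_eval_le (gaussPoly (2 * n)) (natDegree_gaussPoly_le (2 * n))
  set I : ℝ := ∫ u : ℝ, (1 + |u|) ^ (2 * n) * Real.exp (-(2 * u ^ 2)) with hI
  have hI0 : 0 ≤ I := integral_nonneg fun u => by positivity
  set C₂ : ℝ := 2 ^ (m₀ + n) * (Cq * C₁ * 2 ^ n * I) / √Real.pi with hC₂
  have hC₂0 : 0 ≤ C₂ := by positivity
  refine ⟨(m₀ + n).factorial + C₂, by positivity, ?_⟩
  intro F _ _ _ R hR f hf a t ha ht hw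
  have ht0 : 0 < |t| := abs_pos.mpr ht
  -- For |t| < a the right-hand side is bounded below and the L² bound suffices.
  rcases lt_or_ge |t| a with hat | hat
  · refine (norm_apply_schrodingerPsi_le hH hR hf t _ (by positivity)).trans ?_
    have h1 : 1 ≤ (a / |t|) ^ (p - 1 / 2) :=
      Real.one_le_rpow ((one_le_div ht0).mpr hat.le) (by linarith)
    have : (0 : ℝ) ≤ (m₀ + n).factorial := by positivity
    nlinarith
  obtain ⟨b, β, K, hb, hβ, hK, hrep⟩ := funcCalc_transmutation (E := E) hH m₀ n (t := t) ha
  set Y : ℝ := √(a ^ 2 + t ^ 2) with hY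
  have hY2 : Y ^ 2 = a ^ 2 + t ^ 2 := Real.sq_sqrt (by positivity)
  have htY : |t| ≤ Y := Real.abs_le_sqrt (by nlinarith)
  have hY0 : 0 < Y := ht0.trans_le htY
  have hat2 : a ^ 2 ≤ t ^ 2 := by rw [← sq_abs t]; gcongr
  set B : ℝ := ‖β‖ with hB
  have hB0 : 0 < B := by
    rcases (norm_nonneg β).eq_or_lt with h | h
    · rw [hB, ← h] at hβ
      norm_num at hβ
    · exact h
  have hra : 0 < √a := Real.sqrt_pos.mpr ha
  set η : ℝ := √a * B with hη
  set δ : ℝ := √a * B ^ 2 with hδ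
  have hη0 : 0 < η := by positivity
  have hδ0 : 0 < δ := by positivity
  set D : ℝ := Cq * C₁ * (η ^ (2 * p) * 2 ^ n) / (a ^ n * B ^ (2 * n)) with hD
  set G : ℝ → ℝ := fun u => (1 + |u|) ^ (2 * n) * Real.exp (-(2 * u ^ 2)) with hG
  have hGint : Integrable G := integrable_one_add_pow_mul_gauss two_pos (2 * n)
  have hbound : ∀ s ∈ ({0}ᶜ : Set ℝ), ‖R (((gaussPoly (2 * n)).eval (β * s) *
      Complex.exp (-b * (s : ℂ) ^ 2)) • (waveOp H s ∘L psiOp H m₀ a) f)‖ ≤ D * G (δ * s) := by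
    intro s hs
    have hs0 : 0 < |s| := abs_pos.mpr hs
    have hwave := hw |s| hs0
    rw [waveOp_abs hH, sq_abs] at hwave
    -- Here a ≤ |t| is used: Y² = a² + t² ≤ 2t², so the constant 16 leaves at most half of the
    -- Gaussian e^{-as²/(4Y²)} to be spent.
    have hexp : Real.exp (a * s ^ 2 / (16 * t ^ 2)) ≤ Real.exp (a * |s| ^ 2 / (8 * Y ^ 2)) := by
      rw [sq_abs]
      refine Real.exp_le_exp.mpr (div_le_div_of_nonneg_left (by positivity) (by positivity) ?_)
      rw [hY2]
      linarith
    have hmain := transmutation_integrand_le (s := |s|) ha hB0 hβ (hat.trans htY)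
      (by linarith : 0 < p) hn hs0.le
    rw [map_smul, norm_smul, norm_mul, norm_cexp_gauss, hb, ← hY2]
    have hqs : ‖(gaussPoly (2 * n)).eval (β * s)‖ ≤ Cq * (1 + B * |s|) ^ (2 * n) := by
      have := hq (β * s)
      rwa [norm_mul, Complex.norm_real, Real.norm_eq_abs] at this
    rw [← sq_abs s]
    calc _ ≤ (Cq * (1 + B * |s|) ^ (2 * n)) * Real.exp (-(a / (4 * Y ^ 2) * |s| ^ 2)) *
          (C₁ * ((√a / (√a + |s|)) ^ p * Real.exp (a * |s| ^ 2 / (8 * Y ^ 2)))) := by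
          refine mul_le_mul (mul_le_mul_of_nonneg_right hqs (Real.exp_pos _).le)
            (hwave.trans (by gcongr)) (norm_nonneg _) (by positivity)
      _ = Cq * C₁ / (a ^ n * B ^ (2 * n)) * (a ^ n * B ^ (2 * n) * ((1 + B * |s|) ^ (2 * n) *
          Real.exp (-(a / (4 * Y ^ 2) * |s| ^ 2)) *
          ((√a / (√a + |s|)) ^ p * Real.exp (a * |s| ^ 2 / (8 * Y ^ 2))))) := by
          field_simp
      _ ≤ Cq * C₁ / (a ^ n * B ^ (2 * n)) * (η ^ (2 * p) * (2 ^ n * ((1 + δ * |s|) ^ (2 * n) *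
          Real.exp (-(2 * (δ * |s|) ^ 2))))) := by gcongr
      _ = D * G (δ * s) := by
          simp only [hG, hD, abs_mul, abs_of_pos hδ0, mul_pow, sq_abs]
          ring
  have hbi : IntegrableOn (fun s => D * G (δ * s)) ({0}ᶜ : Set ℝ) :=
    ((hGint.comp_mul_left' hδ0.ne').const_mul D).integrableOn
  have hint := norm_apply_setIntegral_le R (measurableSet_singleton (0 : ℝ)).compl hbound hbi
  rw [restrict_compl_singleton, integral_const_mul, Measure.integral_comp_mul_left, smul_eq_mul,
    abs_of_pos (inv_pos.mpr hδ0)] at hint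
  rw [hrep f, map_smul, norm_smul, hK]
  rw [restrict_compl_singleton]
  have hη2 : η ^ 2 ≤ a / |t| := by
    rw [hη, mul_pow, Real.sq_sqrt ha.le, le_div_iff₀ ht0]
    have : B ^ 2 * |t| ≤ 1 := by nlinarith [sq_nonneg B]
    nlinarith
  have hpow : η ^ (2 * p) * η⁻¹ ≤ (a / |t|) ^ (p - 1 / 2) := by
    have e : η ^ (2 * p) * η⁻¹ = (η ^ 2) ^ (p - 1 / 2) := by
      rw [← Real.rpow_neg_one η, ← Real.rpow_add hη0, ← Real.rpow_natCast η 2,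
        ← Real.rpow_mul hη0.le]
      congr 1
      push_cast
      ring
    rw [e]
    exact Real.rpow_le_rpow (by positivity) hη2 (by linarith)
  -- The substitution u = δs costs 1/δ. Together with the factor B of |K| this is B/δ = 1/η, which
  -- lowers the exponent 2p of η to 2p - 1.
  calc _ ≤ 2 ^ (m₀ + n) * (a ^ n * B ^ (2 * n)) * (B / √Real.pi) * (D * (δ⁻¹ * I)) := by
        gcongr
    _ = C₂ * (η ^ (2 * p) * η⁻¹) := by
        rw [hC₂, hD, hδ, hη]
        field_simp
    _ ≤ C₂ * (a / |t|) ^ (p - 1 / 2) := by gcongr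
    _ ≤ ((m₀ + n).factorial + C₂) * (a / |t|) ^ (p - 1 / 2) := by
        gcongr
        simp

/-! ### Lowering the power of H. -/

/-- For x > 0 this is ∫_A^∞ e^{-vx} dv = e^{-Ax}/x. At x = 0 the right-hand side vanishes, which
forces M ≠ 0. -/
lemma psi_eq_integral_Ioi {M : ℕ} (hM : M ≠ 0) {A x : ℝ} (hA : 0 < A) (hx : 0 ≤ x) :
    (psi M (A * x) : ℝ) = A ^ M * ∫ v in Ioi A, (v ^ (M + 1))⁻¹ * psi (M + 1) (v * x) := by
  have h1 : ∀ v ∈ Ioi A, (v ^ (M + 1))⁻¹ * psi (M + 1) (v * x) =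
      x ^ (M + 1) * Real.exp (-x * v) := by
    intro v hv
    have hv0 : 0 < v := hA.trans hv
    rw [psi, mul_pow]
    field_simp
  rw [setIntegral_congr_fun measurableSet_Ioi h1, integral_const_mul]
  rcases hx.eq_or_lt with h | h
  · simp [psi, ← h, hM]
  · rw [integral_exp_mul_Ioi (by linarith), psi]
    field_simp
    ring_nf

/-- Lowering the power of `H` by the formula `x^M e^{-Ax} = ∫_A^∞ x^{M+1} e^{-vx} dv`. -/
lemma funcCalc_schrodingerPsi_eq_integral (hH : IsNonnegSelfAdjoint H) {M : ℕ} (hM : M ≠ 0)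
    {A : ℝ} (hA : 0 < A) (t : ℝ) (f : E) :
    funcCalc H (schrodingerPsi t M A) f = ((A ^ M : ℝ) : ℂ) •
      ∫ v in Ioi A, (((v ^ (M + 1))⁻¹ : ℝ) : ℂ) • funcCalc H (schrodingerPsi t (M + 1) v) f := by
  have hb : ∀ v ∈ Ioi A, ∀ x : ℝ, 0 ≤ x →
      ‖(((v ^ (M + 1))⁻¹ : ℝ) : ℂ) * schrodingerPsi t (M + 1) v x‖ ≤
        (v ^ (M + 1))⁻¹ * (M + 1).factorial := by
    intro v hv x hx
    have hv0 : 0 < v := hA.trans hv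
    rw [norm_mul, Complex.norm_real, Real.norm_of_nonneg (by positivity)]
    exact mul_le_mul_of_nonneg_left (norm_schrodingerPsi_le t _ hv0.le hx) (by positivity)
  have hbi : IntegrableOn (fun v : ℝ => (v ^ (M + 1))⁻¹ * ((M + 1).factorial : ℝ)) (Ioi A) := by
    refine Integrable.mul_const ?_ _
    have := integrableOn_Ioi_rpow_of_lt (a := -((M + 1 : ℕ) : ℝ)) (c := A)
      (by have : (1 : ℝ) ≤ M := by exact_mod_cast Nat.one_le_iff_ne_zero.mpr hM
          push_cast; linarith) hA
    refine this.congr_fun (fun v hv => ?_) measurableSet_Ioi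
    have hv0 : 0 < v := hA.trans hv
    simp only [Real.rpow_neg hv0.le, Real.rpow_natCast]
  have hvc : ContinuousOn (fun v : ℝ => (v ^ (M + 1))⁻¹) (Ioi A) := by
    refine ContinuousOn.inv₀ (by fun_prop) fun v hv => ?_
    have hv0 : 0 < v := hA.trans hv
    positivity
  have hfc : ContinuousOn (Function.uncurry fun v x : ℝ =>
      (((v ^ (M + 1))⁻¹ : ℝ) : ℂ) * schrodingerPsi t (M + 1) v x) (Ioi A ×ˢ Ici 0) := by
    refine ContinuousOn.mul ?_ (continuous_schrodingerPsi t (M + 1)).continuousOn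
    exact Complex.continuous_ofReal.comp_continuousOn
      (hvc.comp continuous_fst.continuousOn fun w hw => hw.1)
  have hmint := funcCalc_setIntegral hH measurableSet_Ioi hfc
    (hvc.mul continuousOn_const) hb hbi f
  have hscalar : ∀ x : ℝ, 0 ≤ x → schrodingerPsi t M A x = ((A ^ M : ℝ) : ℂ) *
      ∫ v in Ioi A, (((v ^ (M + 1))⁻¹ : ℝ) : ℂ) * schrodingerPsi t (M + 1) v x := by
    intro x hx
    have e : ∀ v : ℝ, (((v ^ (M + 1))⁻¹ : ℝ) : ℂ) * schrodingerPsi t (M + 1) v x =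
        Complex.exp (Complex.I * (t * x : ℝ)) *
          (((v ^ (M + 1))⁻¹ * psi (M + 1) (v * x) : ℝ) : ℂ) := by
      intro v
      rw [schrodingerPsi]
      push_cast
      ring
    simp only [e]
    rw [integral_const_mul, integral_complex_ofReal, schrodingerPsi, psi_eq_integral_Ioi hM hA hx]
    push_cast
    ring
  have hgb : ∀ x : ℝ, 0 ≤ x →
      ‖∫ v in Ioi A, (((v ^ (M + 1))⁻¹ : ℝ) : ℂ) * schrodingerPsi t (M + 1) v x‖ ≤
        ∫ v in Ioi A, (v ^ (M + 1))⁻¹ * ((M + 1).factorial : ℝ) := by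
    intro x hx
    refine norm_integral_le_of_norm_le hbi ?_
    filter_upwards [ae_restrict_mem measurableSet_Ioi] with v hv using hb v hv x hx
  have hgc : ContinuousOn (fun x : ℝ => ∫ v in Ioi A,
      (((v ^ (M + 1))⁻¹ : ℝ) : ℂ) * schrodingerPsi t (M + 1) v x) (Ici 0) := by
    refine continuousOn_of_dominated ?_ ?_ hbi ?_
    · intro x hx
      refine ContinuousOn.aestronglyMeasurable ?_ measurableSet_Ioi
      exact hfc.comp (Continuous.prodMk_left x).continuousOn fun v hv => ⟨hv, hx⟩
    · intro x hx
      filter_upwards [ae_restrict_mem measurableSet_Ioi] with v hv using hb v hv x hx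
    · filter_upwards [ae_restrict_mem measurableSet_Ioi] with v hv
      exact hfc.comp (Continuous.prodMk_right v).continuousOn fun x hx => ⟨hv, hx⟩
  rw [funcCalc_congr hH hscalar, funcCalc_const_mul hH hgc hgb, smul_apply, hmint]
  congr 1
  refine setIntegral_congr_fun measurableSet_Ioi fun v hv => ?_
  have hv0 : 0 < v := hA.trans hv
  rw [funcCalc_const_mul hH (f := schrodingerPsi t (M + 1) v)
    ((continuous_schrodingerPsi t (M + 1)).comp
    (Continuous.prodMk_right v)).continuousOn
    (fun x hx => norm_schrodingerPsi_le t _ hv0.le hx), smul_apply]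

/-- The bound of order M + 1 is integrated against v^{-(M+1)} over v > A. The integral of v^{q-M-1}
converges exactly because q < M, and produces 1/(M-q). Only scales v > A occur, which is why
dispersion is later needed at all scales above a threshold. -/
lemma norm_schrodingerPsi_descend (hH : IsNonnegSelfAdjoint H) {F : Type*} [NormedAddCommGroup F]
    [NormedSpace ℂ F] [CompleteSpace F] {R : E →L[ℂ] F} {f : E} {t q C A : ℝ} {M : ℕ}
    (hq : 0 < q) (hM : q < M) (ht : t ≠ 0) (hA : 0 < A)
    (h : ∀ v : ℝ, A < v →
      ‖R (funcCalc H (schrodingerPsi t (M + 1) v) f)‖ ≤ C * (v / |t|) ^ q) :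
    ‖R (funcCalc H (schrodingerPsi t M A) f)‖ ≤ C / (M - q) * (A / |t|) ^ q := by
  have hM0 : M ≠ 0 := by
    rintro rfl
    simp only [Nat.cast_zero] at hM
    linarith
  have ht0 : 0 < |t| := abs_pos.mpr ht
  have hexp : q - (M + 1) < -1 := by linarith
  rw [funcCalc_schrodingerPsi_eq_integral hH hM0 hA, map_smul, norm_smul, Complex.norm_real,
    Real.norm_of_nonneg (by positivity)]
  have hbound : ∀ v ∈ Ioi A,
      ‖R ((((v ^ (M + 1))⁻¹ : ℝ) : ℂ) • funcCalc H (schrodingerPsi t (M + 1) v) f)‖ ≤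
        C / |t| ^ q * v ^ (q - (M + 1)) := by
    intro v hv
    have hv0 : 0 < v := hA.trans hv
    rw [map_smul, norm_smul, Complex.norm_real, Real.norm_of_nonneg (by positivity)]
    refine (mul_le_mul_of_nonneg_left (h v hv) (by positivity)).trans (le_of_eq ?_)
    have e : v ^ (q - (M + 1)) = v ^ q / v ^ (M + 1) := by
      rw [Real.rpow_sub hv0]
      congr 1
      exact_mod_cast Real.rpow_natCast v (M + 1)
    rw [e, Real.div_rpow hv0.le ht0.le]
    field_simp
  have hint := norm_apply_setIntegral_le R measurableSet_Ioi hbound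
    ((integrableOn_Ioi_rpow_of_lt hexp hA).const_mul _)
  rw [integral_const_mul, integral_Ioi_rpow_of_lt hexp hA] at hint
  refine (mul_le_mul_of_nonneg_left hint (by positivity)).trans (le_of_eq ?_)
  have e : q - ((M : ℝ) + 1) + 1 = q - M := by ring
  have hqM : q - M ≠ 0 := by linarith
  have hMq : (M : ℝ) - q ≠ 0 := by linarith
  rw [e, Real.rpow_sub hA, Real.rpow_natCast, Real.div_rpow hA.le ht0.le]
  have e2 : q - (M : ℝ) = -(M - q) := by ring
  rw [e2]
  field_simp

end Core

section Core

variable {E : Type*} [NormedAddCommGroup E] [InnerProductSpace ℂ E] [CompleteSpace E]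
  {H : E →ₗ.[ℂ] E}

theorem exists_norm_schrodingerPsi_le_of_lt (hH : IsNonnegSelfAdjoint H) {q : ℝ} (hq : 0 < q)
    (m₀ : ℕ) {M : ℕ} (hM : q < M) {C₁ : ℝ} (hC₁ : 0 < C₁) :
    ∃ C : ℝ, 0 < C ∧ ∀ (F : Type u) [NormedAddCommGroup F] [NormedSpace ℂ F] [CompleteSpace F]
      (R : E →L[ℂ] F), ‖R‖ ≤ 1 → ∀ f : E, ‖f‖ ≤ 1 → ∀ A t : ℝ, 0 < A → t ≠ 0 →
      (∀ a : ℝ, A ≤ 2 * a → ∀ s : ℝ, 0 < s → ‖R ((waveOp H s ∘L psiOp H m₀ a) f)‖ ≤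
        C₁ * ((√a / (√a + s)) ^ (q + 1 / 2) * Real.exp (a * s ^ 2 / (16 * t ^ 2)))) →
      ‖R (funcCalc H (schrodingerPsi t M A) f)‖ ≤ C * (A / |t|) ^ q := by
  -- The transmutation estimate provides the powers m₀ + n with n ≥ q + 1/2. One of them lies k ≥ 0
  -- steps above M, and the induction on k descends from it.
  obtain ⟨k, n, hk, hn⟩ : ∃ k n : ℕ, M + k = m₀ + n ∧ q + 1 / 2 ≤ n :=
    ⟨m₀ + ⌈q + 1 / 2⌉₊, M + ⌈q + 1 / 2⌉₊, by omega, by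
      push_cast
      linarith [Nat.le_ceil (q + 1 / 2), (Nat.cast_nonneg M : (0 : ℝ) ≤ M)]⟩
  induction k generalizing M with
  | zero =>
    obtain ⟨C, hC, h⟩ := exists_norm_schrodingerPsi_le.{u} hH (by linarith : 1 / 2 < q + 1 / 2)
      m₀ n hn hC₁
    refine ⟨C, hC, fun F _ _ _ R hR f hf A t hA ht hw => ?_⟩
    have := h F R hR f hf (A / 2) t (by positivity) ht (hw (A / 2) (by linarith))
    rw [← hk, add_zero, mul_div_cancel₀ _ two_ne_zero, add_sub_cancel_right] at this
    refine this.trans ?_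
    gcongr
    linarith
  | succ k ih =>
    obtain ⟨C, hC, h⟩ := ih (M := M + 1) (by push_cast; linarith) (by omega)
    refine ⟨C / (M - q), div_pos hC (by linarith), fun F _ _ _ R hR f hf A t hA ht hw => ?_⟩
    exact norm_schrodingerPsi_descend hH hq hM ht hA fun v hv =>
      h F R hR f hf v t (hA.trans hv) ht fun a ha => hw a (hv.le.trans ha)

end Core

/-! ### The Gaussian absorbs the dispersive decay for s ≥ κ. -/

section LargeTime

/-- From t² ≤ (2a)^{1+ε} the exponent y = as²/(16t²) is at least s²/(32 (2a)^ε). A high power of y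
therefore dominates s/√a for s ≥ κ, and e^{y/p} dominates that power. -/
lemma exists_one_le_weight_of_le_one {κ ε p : ℝ} (hκ : 0 < κ) (hε : 0 < ε) (hp : 0 < p) :
    ∃ C : ℝ, 0 < C ∧ ∀ a t s : ℝ, 0 < a → a ≤ 1 → t ≠ 0 → |t| ≤ (2 * a) ^ ((1 + ε) / 2) →
      κ ≤ s → 1 ≤ C * ((√a / (√a + s)) ^ p * Real.exp (a * s ^ 2 / (16 * t ^ 2))) := by
  -- The term 1/(2ε) makes (2a)^{εk} at most a constant times √a. The added 1 gives k ≥ 1, so that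
  -- the exponent 2k - 1 below is not truncated.
  obtain ⟨k, hk⟩ := exists_nat_ge (1 / (2 * ε) + 1)
  have hk1 : 1 ≤ k := by
    have : (1 : ℝ) ≤ k := by
      have : 0 ≤ 1 / (2 * ε) := by positivity
      linarith
    exact_mod_cast this
  have hεk : 1 / 2 ≤ ε * k := by
    have : ε * (1 / (2 * ε)) = 1 / 2 := by field_simp
    nlinarith
  set D : ℝ := (1 + 1 / κ) * (2 ^ (ε * k) * 32 ^ k / κ ^ (2 * k - 1)) * (p ^ k * k.factorial)
    with hD
  have hD0 : 0 < D := by positivity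
  refine ⟨D ^ p, by positivity, fun a t s ha ha1 ht hat hs => ?_⟩
  have hs0 : 0 < s := hκ.trans_le hs
  have hra : 0 < √a := Real.sqrt_pos.mpr ha
  have hra1 : √a ≤ 1 := Real.sqrt_le_one.mpr ha1
  set y : ℝ := a * s ^ 2 / (16 * t ^ 2) with hy
  have ht2 : 0 < t ^ 2 := by positivity
  have hy0 : 0 < y := by positivity
  have hat2 : t ^ 2 ≤ (2 * a) * (2 * a) ^ ε := by
    calc t ^ 2 = |t| ^ 2 := (sq_abs t).symm
      _ ≤ ((2 * a) ^ ((1 + ε) / 2)) ^ 2 := by gcongr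
      _ = (2 * a) ^ (1 + ε) := by
        rw [← Real.rpow_natCast, ← Real.rpow_mul (by positivity)]
        congr 1
        push_cast
        ring
      _ = _ := by rw [Real.rpow_add (by positivity), Real.rpow_one]
  have hylow : s ^ 2 ≤ 32 * (2 * a) ^ ε * y := by
    rw [hy, mul_div_assoc', le_div_iff₀ (by positivity)]
    nlinarith [mul_le_mul_of_nonneg_left hat2 (sq_nonneg s)]
  have hyk : s ^ (2 * k) ≤ 32 ^ k * (2 * a) ^ (ε * k) * y ^ k := by
    calc s ^ (2 * k) = (s ^ 2) ^ k := pow_mul _ _ _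
      _ ≤ (32 * (2 * a) ^ ε * y) ^ k := by gcongr
      _ = _ := by rw [mul_pow, mul_pow, ← Real.rpow_natCast ((2 * a) ^ ε),
                    ← Real.rpow_mul (by positivity)]
  have hak : (2 * a) ^ (ε * k) ≤ 2 ^ (ε * k) * √a := by
    rw [Real.mul_rpow two_pos.le ha.le, Real.sqrt_eq_rpow]
    gcongr 2 ^ (ε * k) * ?_
    exact Real.rpow_le_rpow_of_exponent_ge ha ha1 hεk
  have hsk : κ ^ (2 * k - 1) * s ≤ s ^ (2 * k) := by
    calc κ ^ (2 * k - 1) * s ≤ s ^ (2 * k - 1) * s := by gcongr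
      _ = s ^ (2 * k) := by rw [← pow_succ]; congr 1; omega
  have hexp : y ^ k ≤ p ^ k * k.factorial * Real.exp (y / p) := by
    have h := Real.pow_div_factorial_le_exp (x := y / p) (by positivity) k
    rw [div_le_iff₀ (by positivity), div_pow, div_le_iff₀ (by positivity)] at h
    linarith
  have hsy : s / √a ≤ 2 ^ (ε * k) * 32 ^ k / κ ^ (2 * k - 1) * y ^ k := by
    rw [div_le_iff₀ hra, div_mul_eq_mul_div, div_mul_eq_mul_div, le_div_iff₀ (by positivity)]
    have h := mul_le_mul_of_nonneg_left hak (by positivity : 0 ≤ 32 ^ k * y ^ k)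
    nlinarith
  have hone : 1 ≤ 1 / κ * (s / √a) := by
    rw [div_mul_div_comm, one_mul, one_le_div (by positivity)]
    nlinarith
  have hmain : (√a + s) / √a ≤ D * Real.exp (y / p) := by
    calc (√a + s) / √a = 1 + s / √a := by field_simp
      _ ≤ (1 + 1 / κ) * (s / √a) := by linarith
      _ ≤ (1 + 1 / κ) * (2 ^ (ε * k) * 32 ^ k / κ ^ (2 * k - 1) *
          (p ^ k * k.factorial * Real.exp (y / p))) := by
        gcongr
        exact hsy.trans (by gcongr)
      _ = _ := by rw [hD]; ring
  have hpow : ((√a + s) / √a) ^ p ≤ D ^ p * Real.exp y := by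
    calc ((√a + s) / √a) ^ p ≤ (D * Real.exp (y / p)) ^ p := by gcongr
      _ = D ^ p * Real.exp y := by
        rw [Real.mul_rpow hD0.le (Real.exp_pos _).le, ← Real.exp_mul, div_mul_cancel₀ _ hp.ne']
  have hinv : (√a / (√a + s)) ^ p * ((√a + s) / √a) ^ p = 1 := by
    rw [← Real.mul_rpow (by positivity) (by positivity)]
    have : √a / (√a + s) * ((√a + s) / √a) = 1 := by field_simp
    rw [this, Real.one_rpow]
  calc 1 = (√a / (√a + s)) ^ p * ((√a + s) / √a) ^ p := hinv.symm
    _ ≤ (√a / (√a + s)) ^ p * (D ^ p * Real.exp y) := by gcongr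
    _ = _ := by ring

/-- For times `t` that are small compared with `√a`, the Gaussian factor absorbs the dispersive
decay at distances bounded below. -/
lemma exists_one_le_weight {κ ε p : ℝ} (hκ : 0 < κ) (hε : 0 < ε) (hp : 0 < p) :
    ∃ C : ℝ, 0 < C ∧ ∀ a t s : ℝ, 0 < a → t ≠ 0 → |t| ≤ 1 → |t| ≤ (2 * a) ^ ((1 + ε) / 2) →
      κ ≤ s → 1 ≤ C * ((√a / (√a + s)) ^ p * Real.exp (a * s ^ 2 / (16 * t ^ 2))) := by
  obtain ⟨C, hC, h⟩ := exists_one_le_weight_of_le_one hκ hε hp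
  refine ⟨C, hC, fun a t s ha ht ht1 hat hs => ?_⟩
  rcases le_total a 1 with ha1 | ha1
  · exact h a t s ha ha1 ht hat hs
  -- For a ≥ 1 both factors of the weight increase with a, so the case a = 1 suffices. Its condition
  -- on t follows from |t| ≤ 1.
  · have hs0 : 0 < s := hκ.trans_le hs
    refine (h 1 t s one_pos le_rfl ht (ht1.trans
      (Real.one_le_rpow (by norm_num) (by positivity))) hs).trans ?_
    have h1 : √1 / (√1 + s) ≤ √a / (√a + s) := by
      rw [div_le_div_iff₀ (by positivity) (by positivity)]
      have := Real.sqrt_le_sqrt ha1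
      nlinarith
    gcongr

end LargeTime

/-! ### Calculus of local operator norms. -/

section LocalNorm

variable {X : Type*} [MetricSpace X] [MeasurableSpace X] {μ : Measure X}

lemma enorm_restrict (V : Set X) (g : Lp ℂ 2 μ) :
    ‖LpToLpRestrictCLM X ℂ ℂ μ 2 V g‖ₑ = eLpNorm g 2 (μ.restrict V) := by
  rw [Lp.enorm_def]
  exact eLpNorm_congr_ae (LpToLpRestrictCLM_coeFn ℂ V g)

lemma norm_LpToLpRestrictCLM_le (V : Set X) : ‖LpToLpRestrictCLM X ℂ ℂ μ 2 V‖ ≤ 1 := by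
  refine ContinuousLinearMap.opNorm_le_bound _ zero_le_one fun g => ?_
  rw [one_mul, ← enorm_le_iff_norm_le, enorm_restrict, Lp.enorm_def]
  exact eLpNorm_mono_measure _ Measure.restrict_le_self

lemma localNorm_le {T : Lp ℂ 2 μ →L[ℂ] Lp ℂ 2 μ} {U V : Set X} {c : ℝ}
    (h : ∀ f : Lp ℂ 2 μ, (∀ᵐ x ∂μ, x ∉ U → f x = 0) → ‖f‖ ≤ 1 →
      ‖LpToLpRestrictCLM X ℂ ℂ μ 2 V (T f)‖ ≤ c) : localNorm T U V ≤ ENNReal.ofReal c := by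
  refine iSup_le fun f => iSup_le fun hf => iSup_le fun hf1 => ?_
  rw [← enorm_restrict, ← ofReal_norm]
  exact ENNReal.ofReal_le_ofReal (h f hf hf1)

lemma eLpNorm_le_localNorm (T : Lp ℂ 2 μ →L[ℂ] Lp ℂ 2 μ) {U : Set X} (V : Set X) {f : Lp ℂ 2 μ}
    (hf : ∀ᵐ x ∂μ, x ∉ U → f x = 0) (hf1 : ‖f‖ ≤ 1) :
    eLpNorm (T f) 2 (μ.restrict V) ≤ localNorm T U V :=
  le_iSup_of_le f (le_iSup_of_le hf (le_iSup_of_le hf1 le_rfl))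

lemma norm_le_of_localNorm_le {T : Lp ℂ 2 μ →L[ℂ] Lp ℂ 2 μ} {U V : Set X} {c : ℝ} (hc : 0 ≤ c)
    (h : localNorm T U V ≤ ENNReal.ofReal c) {f : Lp ℂ 2 μ}
    (hf : ∀ᵐ x ∂μ, x ∉ U → f x = 0) (hf1 : ‖f‖ ≤ 1) :
    ‖LpToLpRestrictCLM X ℂ ℂ μ 2 V (T f)‖ ≤ c := by
  rw [← ENNReal.ofReal_le_ofReal_iff hc, ofReal_norm, enorm_restrict]
  exact (eLpNorm_le_localNorm T V hf hf1).trans h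

lemma localNorm_mono (T : Lp ℂ 2 μ →L[ℂ] Lp ℂ 2 μ) {U U' V V' : Set X} (hU : U ⊆ U')
    (hV : V ⊆ V') : localNorm T U V ≤ localNorm T U' V' := by
  refine iSup_le fun f => iSup_le fun hf => iSup_le fun hf1 => ?_
  refine (eLpNorm_mono_measure _ (Measure.restrict_mono hV le_rfl)).trans
    (eLpNorm_le_localNorm T V' ?_ hf1)
  filter_upwards [hf] with x hx hxU using hx fun h => hxU (hU h)

lemma localNorm_le_of_opNorm_le {T : Lp ℂ 2 μ →L[ℂ] Lp ℂ 2 μ} {c : ℝ} (hT : ‖T‖ ≤ c)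
    (U V : Set X) : localNorm T U V ≤ ENNReal.ofReal c := by
  refine localNorm_le fun f _ hf1 => ?_
  refine (ContinuousLinearMap.le_of_opNorm_le _ (norm_LpToLpRestrictCLM_le V) _).trans ?_
  rw [one_mul]
  refine (T.le_of_opNorm_le hT f).trans ?_
  exact mul_le_of_le_one_right ((norm_nonneg _).trans hT) hf1

lemma localNorm_biUnion_right_le [OpensMeasurableSpace X] {ι : Type*}
    (T : Lp ℂ 2 μ →L[ℂ] Lp ℂ 2 μ) (U : Set X) (S : Finset ι) {V : ι → Set X}
    (hV : ∀ i, MeasurableSet (V i)) :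
    localNorm T U (⋃ i ∈ S, V i) ≤ ∑ i ∈ S, localNorm T U (V i) := by
  refine iSup_le fun f => iSup_le fun hf => iSup_le fun hf1 => ?_
  have hg : AEStronglyMeasurable (T f) μ := Lp.aestronglyMeasurable _
  rw [← eLpNorm_indicator_eq_eLpNorm_restrict (S.measurableSet_biUnion fun i _ => hV i)]
  calc eLpNorm ((⋃ i ∈ S, V i).indicator (T f)) 2 μ
      ≤ eLpNorm (∑ i ∈ S, fun x => ‖(V i).indicator (T f) x‖) 2 μ := by
        refine eLpNorm_mono fun x => ?_
        rw [Finset.sum_apply, Real.norm_of_nonneg (Finset.sum_nonneg fun i _ => norm_nonneg _)]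
        by_cases hx : x ∈ ⋃ i ∈ S, V i
        · rw [indicator_of_mem hx]
          obtain ⟨i, hi, hxi⟩ := mem_iUnion₂.mp hx
          refine le_trans ?_ (Finset.single_le_sum
            (f := fun i => ‖(V i).indicator (T f) x‖) (fun i _ => norm_nonneg _) hi)
          simp only [indicator_of_mem hxi, le_refl]
        · rw [indicator_of_notMem hx, norm_zero]
          exact Finset.sum_nonneg fun i _ => norm_nonneg _
    _ ≤ ∑ i ∈ S, eLpNorm (fun x => ‖(V i).indicator (T f) x‖) 2 μ :=
        eLpNorm_sum_le (fun i _ => (hg.indicator (hV i)).norm) (by norm_num)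
    _ ≤ ∑ i ∈ S, localNorm T U (V i) := by
        refine Finset.sum_le_sum fun i _ => ?_
        rw [eLpNorm_norm, eLpNorm_indicator_eq_eLpNorm_restrict (hV i)]
        exact eLpNorm_le_localNorm T (V i) hf hf1

/-- The input is cut into its parts on U and off U. Cutting does not increase the norm, so both
parts are admissible. -/
lemma localNorm_union_left_le (T : Lp ℂ 2 μ →L[ℂ] Lp ℂ 2 μ) {U : Set X} (W V : Set X)
    (hU : MeasurableSet U) : localNorm T (U ∪ W) V ≤ localNorm T U V + localNorm T W V := by
  refine iSup_le fun f => iSup_le fun hf => iSup_le fun hf1 => ?_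
  have hfm : MemLp f 2 μ := Lp.memLp f
  set f₁ : Lp ℂ 2 μ := (hfm.indicator hU).toLp with hf₁
  set f₂ : Lp ℂ 2 μ := (hfm.indicator hU.compl).toLp with hf₂
  have e₁ : f₁ =ᵐ[μ] U.indicator f := MemLp.coeFn_toLp _
  have e₂ : f₂ =ᵐ[μ] Uᶜ.indicator f := MemLp.coeFn_toLp _
  have hsum : f = f₁ + f₂ := by
    refine Lp.ext ?_
    filter_upwards [e₁, e₂, Lp.coeFn_add f₁ f₂] with x h1 h2 h3
    rw [h3, Pi.add_apply, h1, h2, ← Pi.add_apply, indicator_self_add_compl]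
  have hn : ∀ (S : Set X) (g : Lp ℂ 2 μ), g =ᵐ[μ] S.indicator f → ‖g‖ ≤ 1 := by
    intro S g hg
    refine (Lp.norm_le_norm_of_ae_le (g := f) ?_).trans hf1
    filter_upwards [hg] with x hx
    rw [hx]
    exact norm_indicator_le_norm_self _ _
  have h₁ : ∀ᵐ x ∂μ, x ∉ U → f₁ x = 0 := by
    filter_upwards [e₁] with x hx hxU
    rw [hx, indicator_of_notMem hxU]
  have h₂ : ∀ᵐ x ∂μ, x ∉ W → f₂ x = 0 := by
    filter_upwards [e₂, hf] with x hx hfx hxW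
    rw [hx]
    by_cases hxU : x ∈ U
    · exact indicator_of_notMem (by simpa using hxU) _
    · rw [indicator_of_mem (mem_compl hxU)]
      exact hfx fun h => h.elim hxU hxW
  rw [← enorm_restrict, hsum, map_add, map_add]
  refine (enorm_add_le _ _).trans ?_
  rw [enorm_restrict, enorm_restrict]
  exact add_le_add (eLpNorm_le_localNorm T V h₁ (hn _ _ e₁))
    (eLpNorm_le_localNorm T V h₂ (hn _ _ e₂))

lemma localNorm_biUnion_left_le {ι : Type*} (T : Lp ℂ 2 μ →L[ℂ] Lp ℂ 2 μ) (V : Set X)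
    (S : Finset ι) {U : ι → Set X} (hU : ∀ i, MeasurableSet (U i)) :
    localNorm T (⋃ i ∈ S, U i) V ≤ ∑ i ∈ S, localNorm T (U i) V := by
  classical
  induction S using Finset.induction_on with
  | empty =>
    refine iSup_le fun f => iSup_le fun hf => iSup_le fun _ => ?_
    have h0 : f = 0 := by
      refine Lp.ext ?_
      filter_upwards [hf, Lp.coeFn_zero ℂ 2 μ] with x hx h0
      rw [h0, hx (by simp)]
      rfl
    rw [← enorm_restrict, h0]
    simp
  | insert i S hi ih =>
    rw [Finset.sum_insert hi, Finset.set_biUnion_insert]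
    exact (localNorm_union_left_le T _ V (hU i)).trans (add_le_add le_rfl ih)

end LocalNorm

/-! ### Covering balls by balls of half the radius. -/

section Covering

variable {X : Type*} [MetricSpace X] [MeasurableSpace X] {μ : Measure X}

/-- In an Ahlfors regular space, balls that are small compared with the diameter are covered by
boundedly many balls of half the radius. -/
lemma AhlforsRegular.exists_cover [OpensMeasurableSpace X] {d : ℝ} (hμ : AhlforsRegular μ d) :
    ∃ N : ℕ, ∀ (x : X) (r : ℝ), 0 < r → ENNReal.ofReal (2 * r) < Metric.ediam (univ : Set X) →
      ∃ S : Finset X, S.card ≤ N ∧ Metric.ball x r ⊆ ⋃ y ∈ S, Metric.ball y (r / 2) := by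
  classical
  obtain ⟨c, C, hc, hC, h⟩ := hμ
  -- Packing: disjoint balls of radius r/4 inside a ball of radius 2r number at most (C/c) 8^d.
  obtain ⟨N, hN⟩ := exists_nat_gt (C * 8 ^ d / c)
  refine ⟨N, fun x r hr hdiam => ?_⟩
  by_contra! hcon
  -- separated sets of every cardinality at most `N + 1`
  have hsep : ∀ k : ℕ, k ≤ N + 1 → ∃ S : Finset X, S.card = k ∧ ↑S ⊆ Metric.ball x r ∧
      (S : Set X).Pairwise fun y z => r / 2 ≤ dist y z := by
    intro k
    induction k with
    | zero => exact fun _ => ⟨∅, by simp⟩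
    | succ k ih =>
      intro hk
      obtain ⟨S, hSk, hSx, hS⟩ := ih (by omega)
      obtain ⟨z, hz, hzS⟩ := not_subset.mp (hcon S (by omega))
      have hzS' : ∀ y ∈ S, r / 2 ≤ dist z y := by
        intro y hy
        by_contra! hlt
        exact hzS (mem_iUnion₂.mpr ⟨y, hy, hlt⟩)
      have hzn : z ∉ S := by
        intro hzm
        have := hzS' z hzm
        rw [dist_self] at this
        linarith
      refine ⟨insert z S, by rw [Finset.card_insert_of_notMem hzn, hSk], ?_, ?_⟩
      · rw [Finset.coe_insert]
        exact insert_subset hz hSx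
      · rw [Finset.coe_insert]
        refine hS.insert fun y hy _ => ⟨hzS' y hy, ?_⟩
        rw [dist_comm]
        exact hzS' y hy
  obtain ⟨S, hSN, hSx, hS⟩ := hsep (N + 1) le_rfl
  have hdisj : (S : Set X).PairwiseDisjoint fun y => Metric.ball y (r / 4) := by
    intro y hy z hz hyz
    refine Metric.ball_disjoint_ball ?_
    have := hS hy hz hyz
    linarith
  have hsub : ⋃ y ∈ S, Metric.ball y (r / 4) ⊆ Metric.ball x (2 * r) := by
    refine iUnion₂_subset fun y hy => Metric.ball_subset_ball' ?_
    have : dist y x < r := hSx hy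
    linarith
  have hlow : ∀ y ∈ S, ENNReal.ofReal (c * (r / 4) ^ d) ≤ μ (Metric.ball y (r / 4)) := by
    intro y _
    refine (h y (r / 4) (by positivity) (lt_of_le_of_lt ?_ hdiam)).1
    exact ENNReal.ofReal_le_ofReal (by linarith)
  have hmeas : ((N + 1 : ℕ) : ℝ≥0∞) * ENNReal.ofReal (c * (r / 4) ^ d) ≤
      ENNReal.ofReal (C * (2 * r) ^ d) := by
    calc _ = ∑ _y ∈ S, ENNReal.ofReal (c * (r / 4) ^ d) := by
          rw [Finset.sum_const, hSN, nsmul_eq_mul]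
      _ ≤ ∑ y ∈ S, μ (Metric.ball y (r / 4)) := Finset.sum_le_sum hlow
      _ = μ (⋃ y ∈ S, Metric.ball y (r / 4)) :=
          (measure_biUnion_finset hdisj fun y _ => measurableSet_ball).symm
      _ ≤ μ (Metric.ball x (2 * r)) := measure_mono hsub
      _ ≤ _ := (h x (2 * r) (by positivity) hdiam).2
  rw [← ENNReal.ofReal_natCast, ← ENNReal.ofReal_mul (by positivity),
    ENNReal.ofReal_le_ofReal_iff (by positivity)] at hmeas
  have e1 : (r / 4) ^ d = r ^ d / 4 ^ d := Real.div_rpow hr.le (by norm_num) d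
  have e2 : (2 * r) ^ d = 2 ^ d * r ^ d := Real.mul_rpow (by norm_num) hr.le
  have e3 : (8 : ℝ) ^ d = 2 ^ d * 4 ^ d := by
    rw [← Real.mul_rpow (by norm_num) (by norm_num)]
    norm_num
  have hrd : 0 < r ^ d := by positivity
  have h4d : (0 : ℝ) < 4 ^ d := by positivity
  rw [div_lt_iff₀ hc, e3] at hN
  rw [e1, e2] at hmeas
  have h5 : ((N + 1 : ℕ) : ℝ) * c * r ^ d ≤ C * (2 ^ d * 4 ^ d) * r ^ d := by
    calc _ = ((N + 1 : ℕ) : ℝ) * (c * (r ^ d / 4 ^ d)) * 4 ^ d := by field_simp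
      _ ≤ C * (2 ^ d * r ^ d) * 4 ^ d := by gcongr
      _ = _ := by ring
  have h6 := le_of_mul_le_mul_right h5 hrd
  push_cast at h6
  nlinarith

lemma localNorm_ball_le_of_cover [OpensMeasurableSpace X] (T : Lp ℂ 2 μ →L[ℂ] Lp ℂ 2 μ) {N : ℕ}
    {x y : X} {r c : ℝ}
    (hx : ∃ S : Finset X, S.card ≤ N ∧ Metric.ball x r ⊆ ⋃ z ∈ S, Metric.ball z (r / 2))
    (hy : ∃ S : Finset X, S.card ≤ N ∧ Metric.ball y r ⊆ ⋃ z ∈ S, Metric.ball z (r / 2))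
    (h : ∀ x y : X, localNorm T (Metric.ball x (r / 2)) (Metric.ball y (r / 2)) ≤
      ENNReal.ofReal c) :
    localNorm T (Metric.ball x r) (Metric.ball y r) ≤ ENNReal.ofReal (N ^ 2 * c) := by
  obtain ⟨S, hSN, hS⟩ := hx
  obtain ⟨S', hSN', hS'⟩ := hy
  calc localNorm T (Metric.ball x r) (Metric.ball y r)
      ≤ localNorm T (⋃ z ∈ S, Metric.ball z (r / 2)) (⋃ w ∈ S', Metric.ball w (r / 2)) :=
        localNorm_mono T hS hS'
    _ ≤ ∑ z ∈ S, localNorm T (Metric.ball z (r / 2)) (⋃ w ∈ S', Metric.ball w (r / 2)) :=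
        localNorm_biUnion_left_le T _ S fun _ => measurableSet_ball
    _ ≤ ∑ z ∈ S, ∑ w ∈ S', localNorm T (Metric.ball z (r / 2)) (Metric.ball w (r / 2)) :=
        Finset.sum_le_sum fun z _ =>
          localNorm_biUnion_right_le T _ S' fun _ => measurableSet_ball
    _ ≤ ∑ _z ∈ S, ∑ _w ∈ S', ENNReal.ofReal c :=
        Finset.sum_le_sum fun z _ => Finset.sum_le_sum fun w _ => h z w
    _ = ((S.card * S'.card : ℕ) : ℝ≥0∞) * ENNReal.ofReal c := by
        simp only [Finset.sum_const, nsmul_eq_mul]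
        push_cast
        ring
    _ ≤ ((N ^ 2 : ℕ) : ℝ≥0∞) * ENNReal.ofReal c := by
        gcongr
        rw [sq]
        exact Nat.mul_le_mul hSN hSN'
    _ = ENNReal.ofReal (N ^ 2 * c) := by
        rw [ENNReal.ofReal_mul (by positivity), ← ENNReal.ofReal_natCast]
        push_cast
        rfl

end Covering

/-! ### Merging the two spectral cutoffs. -/

section Compose

variable {E : Type*} [NormedAddCommGroup E] [InnerProductSpace ℂ E] [CompleteSpace E]
  {H : E →ₗ.[ℂ] E}

lemma schrodingerOp_comp_psiOp_eq (hH : IsNonnegSelfAdjoint H) (t : ℝ) (m m' : ℕ) {h r : ℝ}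
    (hh : 0 < h) :
    schrodingerOp H t ∘L psiOp H m' (h ^ 2) ∘L psiOp H m (r ^ 2) =
      ((h ^ (2 * m') * r ^ (2 * m) / (h ^ 2 + r ^ 2) ^ (m + m') : ℝ) : ℂ) •
        funcCalc H (schrodingerPsi t (m + m') (h ^ 2 + r ^ 2)) := by
  have hb : ∀ (k : ℕ) (a x : ℝ), 0 ≤ x → ‖(psi k (a ^ 2 * x) : ℂ)‖ ≤ k.factorial :=
    fun k a x hx => norm_psi_le k (by positivity)
  have h1 := funcCalc_mul hH (f := fun x => (psi m' (h ^ 2 * x) : ℂ))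
    (g := fun x => (psi m (r ^ 2 * x) : ℂ)) (by fun_prop) (by fun_prop) (hb m' h) (hb m r)
  have h2 := funcCalc_mul hH (f := fun x : ℝ => Complex.exp (Complex.I * (t * x : ℝ)))
    (g := fun x => (psi m' (h ^ 2 * x) : ℂ) * (psi m (r ^ 2 * x) : ℂ)) (M := 1)
    (N := m'.factorial * m.factorial) (by fun_prop) (by fun_prop)
    (fun x _ => (norm_exp_I_mul _).le) (fun x hx => by
      rw [norm_mul]
      exact mul_le_mul (hb m' h x hx) (hb m r x hx) (norm_nonneg _) (by positivity))
  have hA : 0 < h ^ 2 + r ^ 2 := by positivity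
  rw [psiOp, psiOp, schrodingerOp, ← h1, ← h2,
    ← funcCalc_const_mul hH (f := schrodingerPsi t (m + m') (h ^ 2 + r ^ 2))
      ((continuous_schrodingerPsi t (m + m')).comp (Continuous.prodMk_right _)).continuousOn
      fun x hx => norm_schrodingerPsi_le t _ hA.le hx]
  refine funcCalc_congr hH fun x _ => ?_
  have e : psi m' (h ^ 2 * x) * psi m (r ^ 2 * x) =
      h ^ (2 * m') * r ^ (2 * m) / (h ^ 2 + r ^ 2) ^ (m + m') *
        psi (m + m') ((h ^ 2 + r ^ 2) * x) := by
    have e1 : Real.exp (-((h ^ 2 + r ^ 2) * x)) =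
        Real.exp (-(h ^ 2 * x)) * Real.exp (-(r ^ 2 * x)) := by
      rw [← Real.exp_add]
      congr 1
      ring
    rw [psi, psi, psi, e1, mul_pow (h ^ 2 + r ^ 2)]
    field_simp
    ring
  rw [schrodingerPsi, ← Complex.ofReal_mul, e]
  push_cast
  ring

lemma norm_schrodingerOp_comp_psiOp_le (hH : IsNonnegSelfAdjoint H) (t : ℝ) (m m' : ℕ)
    (h r : ℝ) :
    ‖schrodingerOp H t ∘L psiOp H m' (h ^ 2) ∘L psiOp H m (r ^ 2)‖ ≤
      m'.factorial * m.factorial := by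
  have hb : ∀ (k : ℕ) (a : ℝ), ‖psiOp H k (a ^ 2)‖ ≤ k.factorial :=
    fun k a => norm_funcCalc_le hH (by fun_prop) fun x hx => norm_psi_le k (by positivity)
  have hs : ‖schrodingerOp H t‖ ≤ 1 :=
    norm_funcCalc_le hH (by fun_prop) fun x _ => (norm_exp_I_mul _).le
  refine (ContinuousLinearMap.opNorm_comp_le _ _).trans ?_
  rw [← one_mul ((m'.factorial : ℝ) * m.factorial)]
  refine mul_le_mul hs ?_ (norm_nonneg _) zero_le_one
  refine (ContinuousLinearMap.opNorm_comp_le _ _).trans ?_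
  exact mul_le_mul (hb m' h) (hb m r) (norm_nonneg _) (by positivity)

lemma norm_waveOp_comp_psiOp_le (hH : IsNonnegSelfAdjoint H) (s : ℝ) (m : ℕ) {a : ℝ}
    (ha : 0 ≤ a) : ‖waveOp H s ∘L psiOp H m a‖ ≤ m.factorial := by
  rw [waveOp_comp_psiOp hH s m ha]
  refine norm_funcCalc_le hH (by fun_prop) fun x hx => ?_
  rw [norm_mul]
  exact (mul_le_of_le_one_left (norm_nonneg _) (norm_cos_le _)).trans
    (norm_psi_le _ (mul_nonneg ha hx))

/-- Write A = h² + r². Of r^{2m}, the factor r^d is kept and the rest is at most A^{m-d/2}, which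
needs m ≥ d/2. One factor h² is traded for A, and the powers of A then cancel exactly. -/
lemma scale_factor_le {d q h r τ : ℝ} {m m' : ℕ} (hq : q = (d - 2) / 2) (hm : d / 2 ≤ m)
    (hh : 0 < h) (hr : 0 < r) (hτ : 0 < τ) :
    h ^ (2 * m') * r ^ (2 * m) / (h ^ 2 + r ^ 2) ^ (m + m') * ((h ^ 2 + r ^ 2) / τ) ^ q ≤
      r ^ d / (τ ^ q * h ^ 2) := by
  set A := h ^ 2 + r ^ 2 with hA
  have hA0 : 0 < A := by positivity
  have h1 : h ^ (2 * m') * h ^ 2 ≤ A ^ (m' + 1) := by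
    calc h ^ (2 * m') * h ^ 2 = (h ^ 2) ^ (m' + 1) := by ring
      _ ≤ A ^ (m' + 1) := by gcongr; rw [hA]; nlinarith
  have h2 : r ^ (2 * m) ≤ r ^ d * A ^ ((m : ℝ) - d / 2) := by
    have e : r ^ (2 * m) = r ^ d * (r ^ 2) ^ ((m : ℝ) - d / 2) := by
      rw [← Real.rpow_natCast, ← Real.rpow_natCast r 2, ← Real.rpow_mul hr.le,
        ← Real.rpow_add hr]
      congr 1
      push_cast
      ring
    rw [e]
    gcongr
    rw [hA]
    nlinarith
  have h3 : A ^ ((m : ℝ) - d / 2) * A ^ q * A = A ^ m := by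
    rw [← Real.rpow_add hA0, ← Real.rpow_add_one hA0.ne', ← Real.rpow_natCast]
    congr 1
    rw [hq]
    ring
  rw [Real.div_rpow hA0.le hτ.le, div_mul_div_comm, div_le_div_iff₀ (by positivity) (by positivity)]
  calc h ^ (2 * m') * r ^ (2 * m) * A ^ q * (τ ^ q * h ^ 2)
      = (h ^ (2 * m') * h ^ 2) * r ^ (2 * m) * A ^ q * τ ^ q := by ring
    _ ≤ A ^ (m' + 1) * (r ^ d * A ^ ((m : ℝ) - d / 2)) * A ^ q * τ ^ q := by gcongr
    _ = r ^ d * ((A ^ ((m : ℝ) - d / 2) * A ^ q * A) * A ^ m' * τ ^ q) := by ring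
    _ = r ^ d * (A ^ (m + m') * τ ^ q) := by rw [h3]; ring

end Compose

/-! ### Assembling the Schrödinger estimate. -/

section Main

variable {X : Type*} [MetricSpace X] [MeasurableSpace X] [BorelSpace X] {μ : Measure X}
  {H : Lp ℂ 2 μ →ₗ.[ℂ] Lp ℂ 2 μ}

/-- The Schrödinger estimate on a set of parameters `(h, t)` for which the wave dispersion
estimate holds up to a Gaussian factor at all distances. -/
theorem exists_localNorm_schrodinger_le {d : ℝ} (hd : 2 < d) (hμ : AhlforsRegular μ d)
    (hH : IsNonnegSelfAdjoint H) (m₀ : ℕ) {m : ℕ} (hm : ⌈d / 2⌉₊ ≤ m) (m' : ℕ)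
    {Q : ℝ → ℝ → Prop} (hQ : ∀ h t, Q h t → 0 < h ∧ h ≤ 1 ∧ t ≠ 0 ∧ |t| ≤ 1)
    {C₁ : ℝ} (hC₁ : 0 < C₁)
    (hw : ∀ h t, Q h t → ∀ a : ℝ, h ^ 2 ≤ 2 * a → ∀ s : ℝ, 0 < s → ∀ x y : X,
      localNorm (waveOp H s ∘L psiOp H m₀ a) (Metric.ball x √a) (Metric.ball y √a) ≤
        ENNReal.ofReal (C₁ * ((√a / (√a + s)) ^ ((d - 1) / 2) *
          Real.exp (a * s ^ 2 / (16 * t ^ 2))))) :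
    ∃ C : ℝ, 0 < C ∧ ∀ r : ℝ, 0 < r → ∀ x y : X, ∀ h t : ℝ, Q h t →
      localNorm (schrodingerOp H t ∘L psiOp H m' (h ^ 2) ∘L psiOp H m (r ^ 2))
          (Metric.ball x r) (Metric.ball y r) ≤
        ENNReal.ofReal (C * (r ^ d / (|t| ^ ((d - 2) / 2) * h ^ 2))) := by
  have hmd : d / 2 ≤ m := (Nat.le_ceil _).trans (by exact_mod_cast hm)
  have hq : 0 < (d - 2) / 2 := by linarith
  have hqp : (d - 2) / 2 + 1 / 2 = (d - 1) / 2 := by ring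
  have hqM : (d - 2) / 2 < ((m + m' : ℕ) : ℝ) := by
    push_cast
    linarith [(Nat.cast_nonneg m' : (0 : ℝ) ≤ m')]
  obtain ⟨C, hC, hmain⟩ := exists_norm_schrodingerPsi_le_of_lt hH hq m₀ hqM hC₁
  have hsmall : ∀ r : ℝ, 0 < r → ∀ h t : ℝ, Q h t → ∀ x y : X,
      localNorm (schrodingerOp H t ∘L psiOp H m' (h ^ 2) ∘L psiOp H m (r ^ 2))
          (Metric.ball x (r / 2)) (Metric.ball y (r / 2)) ≤
        ENNReal.ofReal (C * (r ^ d / (|t| ^ ((d - 2) / 2) * h ^ 2))) := by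
    intro r hr h t hht x y
    obtain ⟨hh, -, ht, -⟩ := hQ h t hht
    have ht0 : 0 < |t| := abs_pos.mpr ht
    refine localNorm_le fun f hf hf1 => ?_
    have hest := hmain _ (LpToLpRestrictCLM X ℂ ℂ μ 2 (Metric.ball y (r / 2)))
      (norm_LpToLpRestrictCLM_le _) f hf1 (h ^ 2 + r ^ 2) t (by positivity) ht (by
        intro a ha s hs
        rw [hqp]
        -- From 2a ≥ h² + r² one gets √a ≥ r/√2. This need not reach r, so the estimate is first
        -- proved on balls of radius r/2.
        have hra : r / 2 ≤ √a := Real.le_sqrt_of_sq_le (by nlinarith [sq_nonneg h])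
        have hloc := (localNorm_mono (waveOp H s ∘L psiOp H m₀ a)
          (Metric.ball_subset_ball (x := x) hra) (Metric.ball_subset_ball (x := y) hra)).trans
          (hw h t hht a (by nlinarith [sq_nonneg r]) s hs x y)
        exact norm_le_of_localNorm_le (by positivity) hloc hf hf1)
    rw [schrodingerOp_comp_psiOp_eq hH t m m' hh, smul_apply, map_smul, norm_smul,
      Complex.norm_real, Real.norm_of_nonneg (by positivity)]
    calc _ ≤ h ^ (2 * m') * r ^ (2 * m) / (h ^ 2 + r ^ 2) ^ (m + m') *
          (C * ((h ^ 2 + r ^ 2) / |t|) ^ ((d - 2) / 2)) := by gcongr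
      _ = C * (h ^ (2 * m') * r ^ (2 * m) / (h ^ 2 + r ^ 2) ^ (m + m') *
          ((h ^ 2 + r ^ 2) / |t|) ^ ((d - 2) / 2)) := by ring
      _ ≤ _ := by
        gcongr
        exact scale_factor_le rfl hmd hh hr ht0
  obtain ⟨N, hN⟩ := hμ.exists_cover
  set D : ℝ := (Metric.ediam (univ : Set X)).toReal with hD
  set C₂ : ℝ := m'.factorial * m.factorial / (D / 2) ^ d with hC₂
  have hD0 : 0 ≤ D := ENNReal.toReal_nonneg
  have hC₂0 : 0 ≤ C₂ := by positivity
  -- The bound N + 1 instead of N leaves room for a one-element cover when X is a single point.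
  refine ⟨(((N + 1 : ℕ) : ℝ)) ^ 2 * C + C₂, by positivity, fun r hr x y h t hht => ?_⟩
  obtain ⟨hh, hh1, ht, ht1⟩ := hQ h t hht
  have ht0 : 0 < |t| := abs_pos.mpr ht
  have hX0 : 0 ≤ r ^ d / (|t| ^ ((d - 2) / 2) * h ^ 2) := by positivity
  by_cases hcov : ∀ z : X, ∃ S : Finset X, S.card ≤ N + 1 ∧
      Metric.ball z r ⊆ ⋃ w ∈ S, Metric.ball w (r / 2)
  · refine (localNorm_ball_le_of_cover _ (hcov x) (hcov y) (hsmall r hr h t hht)).trans ?_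
    refine ENNReal.ofReal_le_ofReal ?_
    rw [add_mul, mul_assoc]
    exact le_add_of_nonneg_right (by positivity)
  -- If covering fails, then r ≥ D/2 with D the diameter, here finite and positive. Since |t| ≤ 1
  -- and h ≤ 1, the right-hand side is bounded below and the L² bound is enough.
  · have hdiam : Metric.ediam (univ : Set X) ≤ ENNReal.ofReal (2 * r) := by
      by_contra! hlt
      exact hcov fun z => (hN z r hr hlt).imp fun S hS => ⟨hS.1.trans (Nat.le_succ N), hS.2⟩
    have hDr : D ≤ 2 * r := ENNReal.toReal_le_of_le_ofReal (by positivity) hdiam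
    have hDpos : 0 < D := by
      refine lt_of_le_of_ne hD0 fun h0 => hcov fun z => ⟨{z}, by simp, fun w _ => ?_⟩
      have he : Metric.ediam (univ : Set X) = 0 :=
        ((ENNReal.toReal_eq_zero_iff _).mp h0.symm).resolve_right
          (ne_top_of_le_ne_top ENNReal.ofReal_ne_top hdiam)
      have hwz : w = z := Metric.ediam_eq_zero_iff.mp he (mem_univ w) (mem_univ z)
      simp [hwz, hr]
    refine (localNorm_le_of_opNorm_le (norm_schrodingerOp_comp_psiOp_le hH t m m' h r) _ _).trans
      (ENNReal.ofReal_le_ofReal ?_)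
    have hden : |t| ^ ((d - 2) / 2) * h ^ 2 ≤ 1 :=
      mul_le_one₀ (Real.rpow_le_one ht0.le ht1 hq.le) (by positivity) (pow_le_one₀ hh.le hh1)
    have hnum : (D / 2) ^ d ≤ r ^ d := Real.rpow_le_rpow (by positivity) (by linarith) (by linarith)
    have hDd : 0 < (D / 2) ^ d := by positivity
    calc (m'.factorial * m.factorial : ℝ) = C₂ * (D / 2) ^ d := by
          rw [hC₂]; field_simp
      _ ≤ C₂ * (r ^ d / (|t| ^ ((d - 2) / 2) * h ^ 2)) := by
          gcongr
          rw [le_div_iff₀ (by positivity)]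
          nlinarith
      _ ≤ _ := by
          gcongr
          exact le_add_of_nonneg_left (by positivity)

/-- This is dispersion at radius r = √a; the exponential is at least 1 and costs nothing. It brings
the range s < κ to the form also used for s ≥ κ. -/
lemma localNorm_waveOp_le {d : ℝ} {κ : ℝ≥0∞} {m₀ : ℕ} {C s : ℝ} (hs : 0 < s)
    (hsκ : ENNReal.ofReal s < κ)
    (h : ∀ s : ℝ, 0 < s → ENNReal.ofReal s < κ → ∀ r : ℝ, 0 < r → ∀ x y : X,
      localNorm (waveOp H s ∘L psiOp H m₀ (r ^ 2)) (Metric.ball x r) (Metric.ball y r) ≤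
        ENNReal.ofReal (C * (r / (r + s)) ^ ((d - 1) / 2))) (hC : 0 ≤ C)
    {a : ℝ} (ha : 0 < a) (t : ℝ) (x y : X) :
    localNorm (waveOp H s ∘L psiOp H m₀ a) (Metric.ball x √a) (Metric.ball y √a) ≤
      ENNReal.ofReal (C * ((√a / (√a + s)) ^ ((d - 1) / 2) *
        Real.exp (a * s ^ 2 / (16 * t ^ 2)))) := by
  have h1 := h s hs hsκ √a (Real.sqrt_pos.mpr ha) x y
  rw [Real.sq_sqrt ha.le] at h1
  refine h1.trans (ENNReal.ofReal_le_ofReal ?_)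
  gcongr
  refine le_mul_of_one_le_right (by positivity) ?_
  exact Real.one_le_exp (by positivity)

end Main

end WaveDispersion

theorem mainTheorem2 {X : Type*} [MetricSpace X] [MeasurableSpace X] [BorelSpace X]
    (μ : Measure X) [SigmaFinite μ] (d : ℝ) (hd : 2 < d)
    (hμ : WaveDispersion.AhlforsRegular μ d)
    (H : Lp ℂ 2 μ →ₗ.[ℂ] Lp ℂ 2 μ)
    (hH : WaveDispersion.IsNonnegSelfAdjoint H)
    (hDUE : WaveDispersion.HeatKernelDiagonalEstimate H)
    (hDG : WaveDispersion.DaviesGaffney H)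
    (κ : ℝ≥0∞) (hκ : 0 < κ) (m₀ : ℕ)
    (hwave : WaveDispersion.HasWaveDispersion H d κ m₀)
    (m : ℕ) (hm : ⌈d / 2⌉₊ ≤ m) (m' : ℕ) :
    (κ = ∞ → ∃ C : ℝ, 0 < C ∧
      ∀ r : ℝ, 0 < r → ∀ x y : X, ∀ h : ℝ, 0 < h → h ≤ 1 → ∀ t : ℝ, 0 < |t| → |t| ≤ 1 →
        WaveDispersion.localNorm
            (WaveDispersion.schrodingerOp H t ∘L WaveDispersion.psiOp H m' (h ^ 2) ∘L
              WaveDispersion.psiOp H m (r ^ 2))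
            (Metric.ball x r) (Metric.ball y r) ≤
          ENNReal.ofReal (C * (r ^ d / (|t| ^ ((d - 2) / 2) * h ^ 2)))) ∧
    (κ < ∞ → ∀ ε : ℝ, 0 < ε → ∃ C : ℝ, 0 < C ∧
      ∀ r : ℝ, 0 < r → ∀ x y : X, ∀ h : ℝ, 0 < h → h ≤ 1 →
        ∀ t : ℝ, h ^ 2 ≤ |t| → |t| ≤ h ^ (1 + ε) →
        WaveDispersion.localNorm
            (WaveDispersion.schrodingerOp H t ∘L WaveDispersion.psiOp H m' (h ^ 2) ∘L
              WaveDispersion.psiOp H m (r ^ 2))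
            (Metric.ball x r) (Metric.ball y r) ≤
          ENNReal.ofReal (C * (r ^ d / (|t| ^ ((d - 2) / 2) * h ^ 2)))) := by
  obtain ⟨Cw, hCw, hw⟩ := hwave
  refine ⟨fun hκ' => ?_, fun hκ' ε hε => ?_⟩
  · obtain ⟨C, hC, h⟩ := WaveDispersion.exists_localNorm_schrodinger_le hd hμ hH m₀ hm m'
      (Q := fun h t => 0 < h ∧ h ≤ 1 ∧ t ≠ 0 ∧ |t| ≤ 1) (fun _ _ h => h) hCw
      (fun h t hht a ha s hs x y => WaveDispersion.localNorm_waveOp_le hs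
        (hκ' ▸ ENNReal.ofReal_lt_top) hw hCw.le
        (by have := pow_pos hht.1 2; linarith) t x y)
    exact ⟨C, hC, fun r hr x y a ha ha1 t ht ht1 =>
      h r hr x y a t ⟨ha, ha1, abs_pos.mp ht, ht1⟩⟩
  · have hκ0 : 0 < κ.toReal := ENNReal.toReal_pos hκ.ne' hκ'.ne
    obtain ⟨Ck, hCk, hk⟩ := WaveDispersion.exists_one_le_weight hκ0 hε
      (by linarith : 0 < (d - 1) / 2)
    have hQ : ∀ h t : ℝ, (0 < h ∧ h ≤ 1 ∧ h ^ 2 ≤ |t| ∧ |t| ≤ h ^ (1 + ε)) →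
        0 < h ∧ h ≤ 1 ∧ t ≠ 0 ∧ |t| ≤ 1 := by
      rintro h t ⟨h0, h1, ht, ht'⟩
      exact ⟨h0, h1, abs_pos.mp ((pow_pos h0 2).trans_le ht),
        ht'.trans (Real.rpow_le_one h0.le h1 (by linarith))⟩
    obtain ⟨C, hC, h⟩ := WaveDispersion.exists_localNorm_schrodinger_le hd hμ hH m₀ hm m' hQ
      -- The first summand serves s < κ through dispersion. The second serves s ≥ κ, where the
      -- operator norm is at most m₀! and `Ck` times the weight is at least 1.
      (C₁ := Cw + m₀.factorial * Ck) (by positivity) (by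
        intro h t hht a ha s hs x y
        obtain ⟨h0, -, ht0, ht1⟩ := hQ h t hht
        have ha0 : 0 < a := by have := pow_pos h0 2; linarith
        rcases lt_or_ge (ENNReal.ofReal s) κ with hsκ | hsκ
        · refine (WaveDispersion.localNorm_waveOp_le hs hsκ hw hCw.le ha0 t x y).trans
            (ENNReal.ofReal_le_ofReal ?_)
          gcongr
          exact le_add_of_nonneg_right (by positivity)
        · refine (WaveDispersion.localNorm_le_of_opNorm_le
            (WaveDispersion.norm_waveOp_comp_psiOp_le hH s m₀ ha0.le) _ _).trans
            (ENNReal.ofReal_le_ofReal ?_)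
          -- Here |t| ≤ h^{1+ε} is used, and h² ≤ 2a passes it to every scale a that occurs.
          have hta : |t| ≤ (2 * a) ^ ((1 + ε) / 2) := by
            refine hht.2.2.2.trans ?_
            have e : h ^ (1 + ε) = (h ^ 2) ^ ((1 + ε) / 2) := by
              rw [← Real.rpow_natCast h 2, ← Real.rpow_mul h0.le]
              congr 1
              push_cast
              ring
            rw [e]
            gcongr
          have h1 := hk a t s ha0 ht0 ht1 hta (ENNReal.toReal_le_of_le_ofReal hs.le hsκ)
          calc (m₀.factorial : ℝ) ≤ m₀.factorial * (Ck * ((√a / (√a + s)) ^ ((d - 1) / 2) *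
                Real.exp (a * s ^ 2 / (16 * t ^ 2)))) :=
                le_mul_of_one_le_right (by positivity) h1
            _ = m₀.factorial * Ck * ((√a / (√a + s)) ^ ((d - 1) / 2) *
                Real.exp (a * s ^ 2 / (16 * t ^ 2))) := by ring
            _ ≤ _ := by
                gcongr
                exact le_add_of_nonneg_left hCw.le)
    exact ⟨C, hC, fun r hr x y a ha ha1 t ht ht1 => h r hr x y a t ⟨ha, ha1, ht, ht1⟩⟩
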